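/- Let $\mathcal{G}$ be a Grothendieck category and let $\mathbf{t}=(\mathcal{T},\mathcal{F})$ be a torsion pair in $\mathcal{G}$, that is, a pair of full subcategories closed under isomorphisms such that $\mathrm{Hom}_{\mathcal{G}}(T,F)=0$ for all $T\in\mathcal{T}$, $F\in\mathcal{F}$, and such that each object $X$ of $\mathcal{G}$ fits in a short exact sequence $0\to T_X\to X\to F_X\to 0$ with $T_X\in\mathcal{T}$ and $F_X\in\mathcal{F}$. Let $\mathcal{H}_{\mathbf{t}}$ be the heart of the associated Happel–Reiten–Smalø t-structure in the derived category $\mathcal{D}(\mathcal{G})$, i.e. the (abelian) full subcategory of the complexes $M$ with $H^{-1}(M)\in\mathcal{F}$, $H^{0}(M)\in\mathcal{T}$ and $H^{k}(M)=0$ for $k\neq -1,0$. (1) Suppose that $\mathbf{t}$ satisfies at least one of the following conditions: (a) $\mathbf{t}$ is hereditary, i.e. $\mathcal{T}$ is closed under subobjects; (b) each object of $\mathcal{H}_{\mathbf{t}}$ is isomorphic in $\mathcal{D}(\mathcal{G})$ to a complex $F$ such that $F^{k}=0$ for $k\neq -1,0$ and $F^{k}\in\mathcal{F}$ for $k=-1,0$;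 (c) each object of $\mathcal{H}_{\mathbf{t}}$ is isomorphic in $\mathcal{D}(\mathcal{G})$ to a complex $T$ such that $T^{k}=0$ for $k\neq -1,0$ and $T^{k}\in\mathcal{T}$ for $k=-1,0$. Then the following assertions are equivalent: 1) $\mathcal{H}_{\mathbf{t}}$ is a Grothendieck category; 2) $\mathcal{H}_{\mathbf{t}}$ is an AB5 abelian category; 3) $\mathcal{F}$ is closed under taking direct limits (colimits of direct systems indexed by directed sets) in $\mathcal{G}$. (2) Suppose that $\mathcal{F}$ is a generating class (every object of $\mathcal{G}$ is a quotient of an object of $\mathcal{F}$) or that $\mathcal{T}$ is a cogenerating class (every object of $\mathcal{G}$ is a subobject of an object of $\mathcal{T}$). Then $\mathcal{H}_{\mathbf{t}}$ is a Grothendieck category if and only if $\mathcal{F}$ is closed under taking direct limits in $\mathcal{G}$. -/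

import Mathlib

open CategoryTheory Limits Triangulated Pretriangulated ZeroObject

universe w v u

/-! ### The heart of a t-structure is an abelian category -/

namespace CategoryTheory.Triangulated.TStructure

section

variable {C : Type u} [Category.{v} C] [Preadditive C] [HasZeroObject C] [HasShift C ℤ]
  [∀ (n : ℤ), (shiftFunctor C n).Additive] [Pretriangulated C]

lemma heart_hom_shift_eq_zero (t : TStructure C) ⦃X Y : t.heart.FullSubcategory⦄ ⦃n : ℤ⦄
    (f : t.heart.ι.obj X ⟶ (t.heart.ι.obj Y)⟦n⟧) (hn : n < 0) : f = 0 := by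
  have h₁ : t.IsLE (t.heart.ι.obj X) 0 := ((t.mem_heart_iff _).1 X.property).1
  have h₂ : t.IsGE (t.heart.ι.obj Y) 0 := ((t.mem_heart_iff _).1 Y.property).2
  exact t.zero_of_isLE_of_isGE f 0 (-n) (by lia) h₁ (t.isGE_shift _ 0 n (-n) (by lia))

lemma heart_admissibleMorphism (t : TStructure C) :
    AbelianSubcategory.admissibleMorphism t.heart.ι = ⊤ := by
  ext X₁ X₂ f
  simp only [MorphismProperty.top_apply, iff_true]
  intro X₃ f₂ f₃ hT
  have l₁ : t.IsLE (t.heart.ι.obj X₁) 0 := ((t.mem_heart_iff _).1 X₁.property).1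
  have g₁ : t.IsGE (t.heart.ι.obj X₁) 0 := ((t.mem_heart_iff _).1 X₁.property).2
  have l₂ : t.IsLE (t.heart.ι.obj X₂) 0 := ((t.mem_heart_iff _).1 X₂.property).1
  have g₂ : t.IsGE (t.heart.ι.obj X₂) 0 := ((t.mem_heart_iff _).1 X₂.property).2
  have l₁' := t.isLE_shift (t.heart.ι.obj X₁) 0 1 (-1)
  have l₁'' : t.IsLE ((t.heart.ι.obj X₁)⟦(1 : ℤ)⟧) 0 := t.isLE_of_le _ (-1) 0
  have g₁' := t.isGE_shift (t.heart.ι.obj X₁) 0 1 (-1)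
  have g₂' : t.IsGE (t.heart.ι.obj X₂) (-1) := t.isGE_of_ge _ (-1) 0
  have l₃ : t.IsLE X₃ 0 := t.isLE₂ _ (rot_of_distTriang _ hT) 0 l₂ l₁''
  have g₃ : t.IsGE X₃ (-1) := t.isGE₂ _ (rot_of_distTriang _ hT) (-1) g₂' g₁'
  obtain ⟨A, B, hA, hB, a, b, c, hT'⟩ := t.exists_triangle X₃ (-1) 0 (by simp)
  replace hA : t.IsLE A (-1) := ⟨hA⟩
  replace hB : t.IsGE B 0 := ⟨hB⟩
  have lA := t.isLE_shift A (-1) 1 (-2)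
  have lA' : t.IsLE (A⟦(1 : ℤ)⟧) 0 := t.isLE_of_le _ (-2) 0
  have gB := t.isGE_shift B 0 (-1) 1
  have gB' : t.IsGE (B⟦(-1 : ℤ)⟧) (-1) := t.isGE_of_ge _ (-1) 1
  have hA' : t.IsGE A (-1) := t.isGE₂ _ (inv_rot_of_distTriang _ hT') (-1) gB' g₃
  have hB' : t.IsLE B 0 := t.isLE₂ _ (rot_of_distTriang _ hT') 0 l₃ lA'
  let K : t.heart.FullSubcategory := ⟨A⟦(-1 : ℤ)⟧, (t.mem_heart_iff _).2
    ⟨t.isLE_shift A (-1) (-1) 0, t.isGE_shift A (-1) (-1) 0⟩⟩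
  let Q : t.heart.FullSubcategory := ⟨B, (t.mem_heart_iff _).2 ⟨hB', hB⟩⟩
  let e : (t.heart.ι.obj K)⟦(1 : ℤ)⟧ ≅ A := (shiftEquiv C (1 : ℤ)).counitIso.app A
  refine ⟨K, Q, e.hom ≫ a, b, c ≫ e.inv⟦(1 : ℤ)⟧', ?_⟩
  refine isomorphic_distinguished _ hT' _
    (Triangle.isoMk _ _ e (Iso.refl _) (Iso.refl _) ?_ ?_ ?_)
  · exact Category.comp_id _
  · exact (Category.comp_id _).trans (Category.id_comp _).symm
  · refine Eq.trans ?_ (Category.id_comp _).symm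
    change (c ≫ e.inv⟦(1 : ℤ)⟧') ≫ e.hom⟦(1 : ℤ)⟧' = c
    rw [Category.assoc, ← Functor.map_comp, e.inv_hom_id, Functor.map_id, Category.comp_id]

instance heart_containsZero (t : TStructure C) : t.heart.ContainsZero :=
  ⟨0, isZero_zero C, (t.mem_heart_iff _).2 ⟨inferInstance, inferInstance⟩⟩

instance heart_isClosedUnderBinaryProducts (t : TStructure C) :
    t.heart.IsClosedUnderBinaryProducts := by
  refine ObjectProperty.IsClosedUnderLimitsOfShape.mk' ?_
  rintro _ ⟨F, hF⟩
  have e : limit F ≅ F.obj ⟨.left⟩ ⨯ F.obj ⟨.right⟩ := lim.mapIso (diagramIsoPair F)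
  refine t.heart.prop_of_iso e.symm ?_
  have h₁ := (t.mem_heart_iff _).1 (hF ⟨.left⟩)
  have h₂ := (t.mem_heart_iff _).1 (hF ⟨.right⟩)
  have hT := binaryProductTriangle_distinguished (F.obj ⟨.left⟩) (F.obj ⟨.right⟩)
  exact (t.mem_heart_iff _).2 ⟨t.isLE₂ _ hT 0 h₁.1 h₂.1, t.isGE₂ _ hT 0 h₁.2 h₂.2⟩

instance heart_isClosedUnderFiniteProducts (t : TStructure C) :
    t.heart.IsClosedUnderFiniteProducts := .mk'

/-- The abelian structure on the heart, on top of the preadditive structure that the heart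
inherits as a full subcategory. -/
noncomputable instance heartAbelian [IsTriangulated C] (t : TStructure C) :
    Abelian t.heart.FullSubcategory :=
  AbelianSubcategory.abelian t.heart.ι t.heart_hom_shift_eq_zero t.heart_admissibleMorphism

end

end CategoryTheory.Triangulated.TStructure

/-! ### Torsion pairs and the Happel-Reiten-Smalø t-structure -/

section

variable {A : Type u} [Category.{v} A] [Abelian A]

variable (A) in
/-- A torsion pair `(T, F)` in an abelian category: two full subcategories, closed under
isomorphisms, with `Hom(T, F) = 0`, such that every object `X` is the middle term of a short exact
sequence `0 ⟶ T_X ⟶ X ⟶ F_X ⟶ 0` with `T_X` in `T` and `F_X` in `F`. -/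
structure TorsionPair where
  /-- The torsion class `T`. -/
  torsion : ObjectProperty A
  /-- The torsion-free class `F`. -/
  torsionFree : ObjectProperty A
  torsion_iso : torsion.IsClosedUnderIsomorphisms
  torsionFree_iso : torsionFree.IsClosedUnderIsomorphisms
  hom_eq_zero : ∀ ⦃X Y : A⦄ (f : X ⟶ Y), torsion X → torsionFree Y → f = 0
  exists_shortExact : ∀ X : A, ∃ (T F : A) (i : T ⟶ X) (p : X ⟶ F) (w : i ≫ p = 0),
    torsion T ∧ torsionFree F ∧ (ShortComplex.mk i p w).ShortExact

namespace TorsionPair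

attribute [instance] torsion_iso torsionFree_iso

variable (t : TorsionPair A)

lemma torsion_of_isZero {X : A} (hX : IsZero X) : t.torsion X := by
  obtain ⟨T, F, i, p, w, hT, hF, h⟩ := t.exists_shortExact X
  have := h.mono_f
  have hT' : IsZero T := IsZero.of_mono i hX
  exact t.torsion.prop_of_iso (hT'.iso hX) hT

lemma torsionFree_of_isZero {X : A} (hX : IsZero X) : t.torsionFree X := by
  obtain ⟨T, F, i, p, w, hT, hF, h⟩ := t.exists_shortExact X
  have := h.epi_g
  have hT' : IsZero F := IsZero.of_epi p hX
  exact t.torsionFree.prop_of_iso (hT'.iso hX) hF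

end TorsionPair

namespace DerivedCategory

variable [HasDerivedCategory.{w} A]


open HomologySequence in
lemma isIso_homologyMap_mor₂ (T : Triangle (DerivedCategory A)) (hT : T ∈ distTriang _) (n m : ℤ)
    (hm : n + 1 = m)
    (h₁ : IsZero ((homologyFunctor A n).obj T.obj₁))
    (h₂ : IsZero ((homologyFunctor A m).obj T.obj₁)) :
    IsIso ((homologyFunctor A n).map T.mor₂) := by
  have := (mono_homologyMap_mor₂_iff T hT n).2 (h₁.eq_of_src _ _)
  have := (epi_homologyMap_mor₂_iff T hT n m hm).2 (h₂.eq_of_tgt _ _)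
  exact isIso_of_mono_of_epi _

open HomologySequence in
lemma isIso_homologyMap_mor₁ (T : Triangle (DerivedCategory A)) (hT : T ∈ distTriang _) (m n : ℤ)
    (hm : m + 1 = n)
    (h₁ : IsZero ((homologyFunctor A m).obj T.obj₃))
    (h₂ : IsZero ((homologyFunctor A n).obj T.obj₃)) :
    IsIso ((homologyFunctor A n).map T.mor₁) := by
  have := (mono_homologyMap_mor₁_iff T hT m n hm).2 (h₁.eq_of_src _ _)
  have := (epi_homologyMap_mor₁_iff T hT n).2 (h₂.eq_of_tgt _ _)
  exact isIso_of_mono_of_epi _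

lemma exists_to_single (X : DerivedCategory A) [X.IsLE 0] :
    ∃ (N : A) (g : X ⟶ (singleFunctor A 0).obj N), IsIso ((homologyFunctor A 0).map g) ∧
      ∀ (Y : DerivedCategory A) [Y.IsGE 0] (f : X ⟶ Y), ∃ φ, f = g ≫ φ := by
  obtain ⟨B, C, hB, hC, a, b, c, hT⟩ := DerivedCategory.TStructure.t.exists_triangle X (-1) 0 (by simp)
  replace hB : B.IsLE (-1) := ⟨hB⟩
  replace hC : C.IsGE 0 := ⟨hC⟩
  have lB : IsLE (B⟦(1 : ℤ)⟧) (-2) := DerivedCategory.TStructure.t.isLE_shift B (-1) 1 (-2)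
  have lB' : IsLE (B⟦(1 : ℤ)⟧) 0 := DerivedCategory.TStructure.t.isLE_of_le _ (-2) 0
  have lC : C.IsLE 0 := DerivedCategory.TStructure.t.isLE₂ _ (rot_of_distTriang _ hT) 0 ‹_› lB'
  obtain ⟨N, ⟨e⟩⟩ := exists_iso_singleFunctor_obj_of_isGE_of_isLE C 0
  have h := isIso_homologyMap_mor₂ _ hT 0 1 rfl (isZero_of_isLE B (-1) 0 (by simp))
    (isZero_of_isLE B (-1) 1 (by simp))
  replace h : IsIso ((homologyFunctor A 0).map b) := h
  refine ⟨N, b ≫ e.hom, ?_, fun Y _ f ↦ ?_⟩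
  · rw [Functor.map_comp]; infer_instance
  · obtain ⟨φ, hφ⟩ : ∃ φ : C ⟶ Y, f = b ≫ φ := Triangle.yoneda_exact₂ _ hT f
      (DerivedCategory.TStructure.t.zero_of_isLE_of_isGE _ (-1) 0 (by simp) hB ‹_›)
    exact ⟨e.inv ≫ φ, by simp [hφ]⟩

lemma exists_from_single (Y : DerivedCategory A) [Y.IsGE 0] :
    ∃ (N : A) (g : (singleFunctor A 0).obj N ⟶ Y), IsIso ((homologyFunctor A 0).map g) ∧
      ∀ (X : DerivedCategory A) [X.IsLE 0] (f : X ⟶ Y), ∃ φ, f = φ ≫ g := by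
  obtain ⟨B, C, hB, hC, a, b, c, hT⟩ := DerivedCategory.TStructure.t.exists_triangle Y 0 1 (by simp)
  replace hB : B.IsLE 0 := ⟨hB⟩
  replace hC : C.IsGE 1 := ⟨hC⟩
  have gC : IsGE (C⟦(-1 : ℤ)⟧) 2 := DerivedCategory.TStructure.t.isGE_shift C 1 (-1) 2
  have gC' : IsGE (C⟦(-1 : ℤ)⟧) 0 := DerivedCategory.TStructure.t.isGE_of_ge _ 0 2
  have gB : B.IsGE 0 := DerivedCategory.TStructure.t.isGE₂ _ (inv_rot_of_distTriang _ hT) 0 gC' ‹_›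
  obtain ⟨N, ⟨e⟩⟩ := exists_iso_singleFunctor_obj_of_isGE_of_isLE B 0
  have h := isIso_homologyMap_mor₁ _ hT (-1) 0 rfl (isZero_of_isGE C 1 (-1) (by simp))
    (isZero_of_isGE C 1 0 (by simp))
  replace h : IsIso ((homologyFunctor A 0).map a) := h
  refine ⟨N, e.inv ≫ a, ?_, fun X _ f ↦ ?_⟩
  · rw [Functor.map_comp]; infer_instance
  · obtain ⟨φ, hφ⟩ : ∃ φ : X ⟶ B, f = φ ≫ a := Triangle.coyoneda_exact₂ _ hT f
      (DerivedCategory.TStructure.t.zero_of_isLE_of_isGE _ 0 1 (by simp) ‹_› hC)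
    exact ⟨φ ≫ e.hom, by simp [hφ]⟩

end DerivedCategory

namespace TorsionPair

open DerivedCategory HomologySequence

variable (t : TorsionPair A) [HasDerivedCategory.{w} A]

/-- The isomorphism `H^m(X[a]) ≅ H^n(X)` for `a + m = n`. -/
noncomputable def homologyShiftIso (X : DerivedCategory A) (a m n : ℤ) (h : a + m = n) :
    (homologyFunctor A m).obj (X⟦a⟧) ≅ (homologyFunctor A n).obj X :=
  ((homologyFunctor A 0).shiftIso a m n h).app X

lemma exists_triangle_hrs (X : DerivedCategory A) :
    ∃ (U W : DerivedCategory A) (_ : U.IsLE 0 ∧ t.torsion ((homologyFunctor A 0).obj U))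
      (_ : W.IsGE 0 ∧ t.torsionFree ((homologyFunctor A 0).obj W))
      (f : U ⟶ X) (g : X ⟶ W) (h : W ⟶ U⟦(1 : ℤ)⟧), Triangle.mk f g h ∈ distTriang _ := by
  obtain ⟨B, C, hB, hC, a, b, c, hT⟩ := DerivedCategory.TStructure.t.exists_triangle X 0 1 (by simp)
  replace hB : B.IsLE 0 := ⟨hB⟩
  replace hC : C.IsGE 1 := ⟨hC⟩
  obtain ⟨N, g, hg, -⟩ := exists_to_single B
  obtain ⟨T, F, i, p, w, hT', hF, hS⟩ := t.exists_shortExact N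
  have := hS.mono_f
  have := hS.epi_g
  let q := g ≫ (singleFunctor A 0).map p
  let eN : ∀ N : A, (homologyFunctor A 0).obj ((singleFunctor A 0).obj N) ≅ N :=
    (singleFunctorCompHomologyFunctorIso A 0).app
  have hp : (homologyFunctor A 0).map ((singleFunctor A 0).map p) ≫ (eN F).hom =
      (eN N).hom ≫ p := (singleFunctorCompHomologyFunctorIso A 0).hom.naturality p
  have hq : (homologyFunctor A 0).map q ≫ (eN F).hom =
      ((homologyFunctor A 0).map g ≫ (eN N).hom) ≫ p := by
    simp only [q, Functor.map_comp, Category.assoc, hp]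
  have hq_epi : Epi ((homologyFunctor A 0).map q) := by
    have : Epi ((homologyFunctor A 0).map q ≫ (eN F).hom) := by rw [hq]; infer_instance
    have h2 : (homologyFunctor A 0).map q = ((homologyFunctor A 0).map q ≫ (eN F).hom) ≫
      (eN F).inv := by simp
    rw [h2]; infer_instance
  obtain ⟨U, u, δ', hU⟩ := distinguished_cocone_triangle₁ q
  obtain ⟨W, v, δ'', hW⟩ := distinguished_cocone_triangle (u ≫ a)
  have O := someOctahedron rfl hU hT hW
  have hO := O.mem
  refine ⟨U, W, ⟨?_, ?_⟩, ⟨?_, ?_⟩, _, _, _, hW⟩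
  · rw [isLE_iff]
    intro k hk
    have h1 : Epi ((homologyFunctor A (k - 1)).map q) := by
      by_cases hk' : k = 1
      · subst hk'; exact hq_epi
      · exact ⟨fun _ _ _ ↦ (isZero_of_isLE _ 0 (k - 1) (by lia)).eq_of_src _ _⟩
    have h2 : Mono ((homologyFunctor A k).map u) := (mono_homologyMap_mor₁_iff _ hU (k - 1) k (by lia)).2
      ((epi_homologyMap_mor₂_iff _ hU (k - 1) k (by lia)).1 h1)
    exact IsZero.of_mono ((homologyFunctor A k).map u) (isZero_of_isLE B 0 k hk)
  · have h1 : Mono ((homologyFunctor A 0).map u) := (mono_homologyMap_mor₁_iff _ hU (-1) 0 rfl).2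
      ((isZero_of_isGE ((singleFunctor A 0).obj F) 0 (-1) (by simp)).eq_of_src _ _)
    have wuq : u ≫ q = 0 := comp_distTriang_mor_zero₁₂ _ hU
    have h2 : (ShortComplex.mk ((homologyFunctor A 0).map u) ((homologyFunctor A 0).map q)
      (by rw [← Functor.map_comp, wuq, Functor.map_zero])).Exact := exact₂ _ hU 0
    have : Mono (ShortComplex.mk ((homologyFunctor A 0).map u) ((homologyFunctor A 0).map q)
      (by rw [← Functor.map_comp, wuq, Functor.map_zero])).f := h1
    have k₁ := ShortComplex.Exact.fIsKernel h2
    have k₂ := hS.fIsKernel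
    refine t.torsion.prop_of_iso ?_ hT'
    exact k₂.conePointUniqueUpToIso (limit.isLimit _) ≪≫
      (kernel.mapIso ((homologyFunctor A 0).map q) p
        (asIso ((homologyFunctor A 0).map g) ≪≫ eN N) (eN F) (by simpa using hq)).symm ≪≫
      (k₁.conePointUniqueUpToIso (limit.isLimit _)).symm
  · have : C.IsGE 0 := DerivedCategory.TStructure.t.isGE_of_ge _ 0 1
    exact DerivedCategory.TStructure.t.isGE₂ _ hO 0 (inferInstanceAs (((singleFunctor A 0).obj F).IsGE 0)) this
  · have h := isIso_homologyMap_mor₁ _ hO (-1) 0 rfl (isZero_of_isGE C 1 (-1) (by simp))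
      (isZero_of_isGE C 1 0 (by simp))
    exact t.torsionFree.prop_of_iso ((eN F).symm ≪≫ @asIso _ _ _ _ _ h) hF

lemma hrs_zero {X Y : DerivedCategory A} (f : X ⟶ Y)
    (hX : X.IsLE 0 ∧ t.torsion ((homologyFunctor A 0).obj X))
    (hY : Y.IsGE 0 ∧ t.torsionFree ((homologyFunctor A 0).obj Y)) : f = 0 := by
  obtain ⟨hX, hX'⟩ := hX
  obtain ⟨hY, hY'⟩ := hY
  let eN : ∀ N : A, (homologyFunctor A 0).obj ((singleFunctor A 0).obj N) ≅ N :=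
    (singleFunctorCompHomologyFunctorIso A 0).app
  obtain ⟨M, g, hg, h⟩ := exists_to_single X
  obtain ⟨N, g', hg', h'⟩ := exists_from_single Y
  obtain ⟨φ, rfl⟩ := h Y f
  obtain ⟨ψ, rfl⟩ := h' _ φ
  obtain ⟨ψ, rfl⟩ := (singleFunctor A 0).map_surjective ψ
  rw [t.hom_eq_zero ψ (t.torsion.prop_of_iso (asIso ((homologyFunctor A 0).map g) ≪≫ eN M) hX')
    (t.torsionFree.prop_of_iso ((asIso ((homologyFunctor A 0).map g')).symm ≪≫ eN N) hY')]
  simp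

/-- The Happel-Reiten-Smalø t-structure attached to a torsion pair `(T, F)`. Its aisle `le 0`
consists of the `X` with `H^i(X) = 0` for `i > 0` and `H^0(X)` in `T`, and its co-aisle `ge 0`
of the `X` with `H^i(X) = 0` for `i < -1` and `H^{-1}(X)` in `F`; `le n` and `ge n` are the shifts
of these by `-n`. -/
noncomputable def tStructure : CategoryTheory.Triangulated.TStructure (DerivedCategory A) where
  le n X := X.IsLE n ∧ t.torsion ((homologyFunctor A n).obj X)
  ge n X := X.IsGE (n - 1) ∧ t.torsionFree ((homologyFunctor A (n - 1)).obj X)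
  le_isClosedUnderIsomorphisms n := ⟨fun {X Y} e h ↦
    have := h.1
    ⟨DerivedCategory.TStructure.t.isLE_of_iso e n,
      t.torsion.prop_of_iso ((homologyFunctor A n).mapIso e) h.2⟩⟩
  ge_isClosedUnderIsomorphisms n := ⟨fun {X Y} e h ↦
    have := h.1
    ⟨DerivedCategory.TStructure.t.isGE_of_iso e (n - 1),
      t.torsionFree.prop_of_iso ((homologyFunctor A (n - 1)).mapIso e) h.2⟩⟩
  le_shift n a n' h X hX :=
    have := hX.1
    ⟨DerivedCategory.TStructure.t.isLE_shift X n a n' h,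
      t.torsion.prop_of_iso (homologyShiftIso X a n' n h).symm hX.2⟩
  ge_shift n a n' h X hX :=
    have := hX.1
    ⟨DerivedCategory.TStructure.t.isGE_shift X (n - 1) a (n' - 1) (by lia),
      t.torsionFree.prop_of_iso (homologyShiftIso X a (n' - 1) (n - 1) (by lia)).symm hX.2⟩
  zero' X Y f hX hY := t.hrs_zero f hX (by simpa using hY)
  le_zero_le X hX :=
    have := hX.1
    ⟨DerivedCategory.TStructure.t.isLE_of_le X 0 1,
      t.torsion_of_isZero (isZero_of_isLE X 0 1 (by simp))⟩
  ge_one_le X hX :=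
    have : X.IsGE 0 := by simpa using hX.1
    ⟨DerivedCategory.TStructure.t.isGE_of_ge X (0 - 1) 0,
      t.torsionFree_of_isZero (isZero_of_isGE X 0 (0 - 1) (by simp))⟩
  exists_triangle_zero_one X := by
    simpa using t.exists_triangle_hrs X

/-- The heart of the Happel-Reiten-Smalø t-structure, a full subcategory of the derived
category. -/
abbrev Heart : Type (max u v) := t.tStructure.heart.FullSubcategory

/-- A torsion pair is hereditary if its torsion class is closed under subobjects. -/
def IsHereditary {A : Type u} [Category.{v} A] [Abelian A] (t : TorsionPair A) : Prop :=
  t.torsion.IsClosedUnderSubobjects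

/-- Each object of the heart is isomorphic in the derived category to a complex which is
concentrated in degrees `-1` and `0` and has its terms in `P`. -/
def HeartRepresentedByTwoTermComplexes (P : ObjectProperty A) : Prop :=
  ∀ M : t.Heart, ∃ K : CochainComplex A ℤ,
    Nonempty (M.obj ≅ DerivedCategory.Q.obj K) ∧
      (∀ k : ℤ, k ≠ -1 → k ≠ 0 → IsZero (K.X k)) ∧ P (K.X (-1)) ∧ P (K.X 0)

end TorsionPair

end

/-! ### Categorical conditions -/

/-- An abelian category is AB5 (with respect to the universe `w`) if filtered colimits, equivalently
direct limits over directed sets, of size `w` exist and are exact. As an abelian category has finite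
colimits, the existence of filtered colimits is the same as the existence of coproducts (AB3). -/
def IsAB5 (C : Type u) [Category.{v} C] [Abelian C] : Prop :=
  ∃ _ : HasFilteredColimitsOfSize.{w, w} C, AB5OfSize.{w, w} C

/-- A class of objects is closed under direct limits if it contains the colimit of every direct
system, indexed by a directed set of size `w`, of objects of the class. -/
def IsClosedUnderDirectLimits {C : Type u} [Category.{v} C] (P : ObjectProperty C) : Prop :=
  ∀ (I : Type w) [PartialOrder I] [IsDirectedOrder I] [Nonempty I],
    P.IsClosedUnderColimitsOfShape I

/-- A class of objects is generating if every object is a quotient of an object of the class. -/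
def IsGeneratingClass {C : Type u} [Category.{v} C] (P : ObjectProperty C) : Prop :=
  ∀ X : C, ∃ (Y : C) (p : Y ⟶ X), P Y ∧ Epi p

/-- A class of objects is cogenerating if every object embeds in an object of the class. -/
def IsCogeneratingClass {C : Type u} [Category.{v} C] (P : ObjectProperty C) : Prop :=
  ∀ X : C, ∃ (Y : C) (i : X ⟶ Y), P Y ∧ Mono i

/-!
Suppose that `𝓕` is closed under direct limits. For a directed preorder `I`, the heart of the
pointwise torsion pair on `I ⥤ G` is equivalent to the category of diagrams in the heart `𝓗` of
`t = (𝓣, 𝓕)`: the evaluations at the elements of `I` have left and right adjoints which are exact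
since `I` is thin, so that they extend to derived categories, and every diagram is the cokernel of
a morphism between diagrams freely generated by their values. Through this equivalence, the
colimit functor on diagrams in `𝓗` is the restriction to hearts of the functor `D(I ⥤ G) ⥤ D(G)`
induced by the exact functor `colim`; it follows that `𝓗` is AB5. If `X` is a separator of `G`,
nonzero morphisms in `𝓗` are detected by the objects `F[1]` for the torsion-free quotients `F` of
`X`, and by those cones of morphisms `Z ⟶ B`, with `B` a coproduct of copies of `X` and `Z` a
quotient of such a coproduct, which belong to `𝓗`: a torsion object is a filtered colimit of the
torsion parts of quotients of finite coproducts of copies of `X`, which bounds the size of the `B`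
and `Z` that are needed.

Conversely, suppose that `𝓗` is AB5, and let `F` be a direct system in `𝓕`. Replacing `F` by the
kernel of `F ⟶ colim F / T`, where `T` is the torsion part of `colim F`, one may assume that
`colim F = T` is torsion; then the colimit of `F[1]` in `𝓗` is zero. The pullbacks of the short
exact sequence `0 ⟶ K ⟶ ⨁ F i ⟶ T ⟶ 0` along the maps `F i ⟶ T` become short exact sequences in
`𝓗` after a shift, and taking their colimit in `𝓗` gives compatible splittings. Hence `T` is a
direct summand of the torsion-free object `⨁ F i`, so that `T = 0`.
-/

universe w' v' u' u''

namespace HRS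

open DerivedCategory

variable {A : Type u} [Category.{v} A] [Abelian A]
  {B : Type u'} [Category.{v'} B] [Abelian B]

/-- The termwise extension to complexes of an adjunction between functors preserving zero
morphisms. -/
def complexAdjunction {Φ : A ⥤ B} {Ψ : B ⥤ A} (adj : Φ ⊣ Ψ)
    [Φ.PreservesZeroMorphisms] [Ψ.PreservesZeroMorphisms] {ι : Type*} (c : ComplexShape ι) :
    Φ.mapHomologicalComplex c ⊣ Ψ.mapHomologicalComplex c where
  unit := { app K := { f i := adj.unit.app (K.X i)
                       comm' _ _ _ := adj.unit_naturality _ }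
            naturality _ _ f := by ext i; exact (adj.unit_naturality (f.f i)).symm }
  counit := { app K := { f i := adj.counit.app (K.X i)
                         comm' _ _ _ := (adj.counit_naturality _).symm }
              naturality _ _ f := by ext i; exact adj.counit_naturality (f.f i) }
  left_triangle_components K := by ext i; exact adj.left_triangle_components (K.X i)
  right_triangle_components K := by ext i; exact adj.right_triangle_components (K.X i)

variable [HasDerivedCategory.{w'} B] [HasDerivedCategory.{w} A]

/-- The data which express that `Φ'` is the functor between derived categories induced by the exact
functor `Φ`. This is a commutative square up to isomorphism rather than the equality
`Φ' = Φ.mapDerivedCategory`, because the evaluations of a diagram in the derived category are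
only isomorphic to the functors `mapDerivedCategory`. -/
abbrev InducedBy (Φ : A ⥤ B) [Φ.Additive] (Φ' : DerivedCategory A ⥤ DerivedCategory B) :=
  CatCommSq (Φ.mapHomologicalComplex (ComplexShape.up ℤ)) Q Q Φ'

noncomputable instance (Φ : A ⥤ B) [Φ.Additive] [PreservesFiniteLimits Φ]
    [PreservesFiniteColimits Φ] : InducedBy Φ Φ.mapDerivedCategory where
  iso := Φ.mapDerivedCategoryFactors.symm

section

variable (Φ : A ⥤ B) [Φ.Additive] [PreservesFiniteLimits Φ] [PreservesFiniteColimits Φ]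
  (Φ' : DerivedCategory A ⥤ DerivedCategory B) [InducedBy Φ Φ']

noncomputable def homologyObjIso (X : DerivedCategory A) (n : ℤ) :
    (homologyFunctor B n).obj (Φ'.obj X) ≅ Φ.obj ((homologyFunctor A n).obj X) :=
  let K := Q.objPreimage X
  let e : Q.obj K ≅ X := Q.objObjPreimageIso X
  (homologyFunctor B n).mapIso (Φ'.mapIso e.symm ≪≫
      ((CatCommSq.iso (Φ.mapHomologicalComplex (ComplexShape.up ℤ)) Q Q Φ').app K).symm) ≪≫
    (homologyFunctorFactors B n).app _ ≪≫ (K.sc n).mapHomologyIso Φ ≪≫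
    Φ.mapIso (((homologyFunctorFactors A n).app K).symm ≪≫ (homologyFunctor A n).mapIso e)

include Φ in
lemma isLE_obj_of_inducedBy (X : DerivedCategory A) (n : ℤ) (hX : X.IsLE n) :
    (Φ'.obj X).IsLE n := by
  rw [isLE_iff] at hX ⊢
  exact fun k hk ↦ (Φ.map_isZero (hX k hk)).of_iso (homologyObjIso Φ Φ' X k)

include Φ in
lemma isGE_obj_of_inducedBy (X : DerivedCategory A) (n : ℤ) (hX : X.IsGE n) :
    (Φ'.obj X).IsGE n := by
  rw [isGE_iff] at hX ⊢
  exact fun k hk ↦ (Φ.map_isZero (hX k hk)).of_iso (homologyObjIso Φ Φ' X k)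

end

section

variable {Φ : A ⥤ B} {Ψ : B ⥤ A} (adj : Φ ⊣ Ψ) [Φ.Additive] [Ψ.Additive]
  (Φ' : DerivedCategory A ⥤ DerivedCategory B) (Ψ' : DerivedCategory B ⥤ DerivedCategory A)
  [InducedBy Φ Φ'] [InducedBy Ψ Ψ']

noncomputable def derivedAdjunction : Φ' ⊣ Ψ' :=
  (complexAdjunction adj (ComplexShape.up ℤ)).localization
    Q (HomologicalComplex.quasiIso A (ComplexShape.up ℤ))
    Q (HomologicalComplex.quasiIso B (ComplexShape.up ℤ)) Φ' Ψ'

lemma derivedAdjunction_counit_app (K : CochainComplex B ℤ) :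
    (derivedAdjunction adj Φ' Ψ').counit.app (Q.obj K) =
      Φ'.map ((CatCommSq.iso (Ψ.mapHomologicalComplex (ComplexShape.up ℤ)) Q Q Ψ').inv.app K) ≫
        (CatCommSq.iso (Φ.mapHomologicalComplex (ComplexShape.up ℤ)) Q Q Φ').inv.app _ ≫
          Q.map ((complexAdjunction adj (ComplexShape.up ℤ)).counit.app K) :=
  Adjunction.localization_counit_app ..

end

lemma isZero_of_isZero_homology (X : DerivedCategory A)
    (hX : ∀ n : ℤ, IsZero ((homologyFunctor A n).obj X)) : IsZero X := by
  have : IsIso (0 : X ⟶ 0) := by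
    rw [isIso_iff]
    exact fun n ↦ ⟨0, (hX n).eq_of_src _ _,
      (Functor.map_isZero (homologyFunctor A n) (isZero_zero _)).eq_of_src _ _⟩
  exact (isZero_zero _).of_iso (asIso (0 : X ⟶ 0))

end HRS

namespace TorsionPair

open DerivedCategory HRS

variable {A : Type u} [Category.{v} A] [Abelian A]
  {B : Type u'} [Category.{v'} B] [Abelian B]
  [HasDerivedCategory.{w} A] [HasDerivedCategory.{w'} B]

lemma mem_heart_iff (t : TorsionPair A) (X : DerivedCategory A) :
    t.tStructure.heart X ↔ (X.IsLE 0 ∧ t.torsion ((homologyFunctor A 0).obj X)) ∧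
      (X.IsGE (-1) ∧ t.torsionFree ((homologyFunctor A (-1)).obj X)) := Iff.rfl

lemma heart_obj_of_inducedBy (t : TorsionPair A) (s : TorsionPair B)
    (Φ : A ⥤ B) [Φ.Additive] [PreservesFiniteLimits Φ] [PreservesFiniteColimits Φ]
    (Φ' : DerivedCategory A ⥤ DerivedCategory B) [InducedBy Φ Φ']
    (hT : ∀ X, t.torsion X → s.torsion (Φ.obj X))
    (hF : ∀ X, t.torsionFree X → s.torsionFree (Φ.obj X)) (X : DerivedCategory A)
    (hX : t.tStructure.heart X) : s.tStructure.heart (Φ'.obj X) := by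
  obtain ⟨⟨hX₀, hT₀⟩, ⟨hX₁, hF₁⟩⟩ := (t.mem_heart_iff X).1 hX
  exact (s.mem_heart_iff _).2
    ⟨⟨isLE_obj_of_inducedBy Φ Φ' X 0 hX₀,
      s.torsion.prop_of_iso (homologyObjIso Φ Φ' X 0).symm (hT _ hT₀)⟩,
    ⟨isGE_obj_of_inducedBy Φ Φ' X (-1) hX₁,
      s.torsionFree.prop_of_iso (homologyObjIso Φ Φ' X (-1)).symm (hF _ hF₁)⟩⟩

variable {t : TorsionPair A} {s : TorsionPair B}

/-- The functor between hearts which is induced by a functor between derived categories. -/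
noncomputable abbrev heartFunctor (Φ' : DerivedCategory A ⥤ DerivedCategory B)
    (hΦ : ∀ X, t.tStructure.heart X → s.tStructure.heart (Φ'.obj X)) : t.Heart ⥤ s.Heart :=
  s.tStructure.heart.lift (t.tStructure.heart.ι ⋙ Φ') fun X ↦ hΦ _ X.property

noncomputable def heartAdjunction {Φ' : DerivedCategory A ⥤ DerivedCategory B}
    {Ψ' : DerivedCategory B ⥤ DerivedCategory A} (adj : Φ' ⊣ Ψ')
    (hΦ : ∀ X, t.tStructure.heart X → s.tStructure.heart (Φ'.obj X))
    (hΨ : ∀ X, s.tStructure.heart X → t.tStructure.heart (Ψ'.obj X)) :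
    heartFunctor Φ' hΦ ⊣ heartFunctor Ψ' hΨ :=
  adj.restrictFullyFaithful t.tStructure.heart.fullyFaithfulι s.tStructure.heart.fullyFaithfulι
    (Iso.refl _) (Iso.refl _)

end TorsionPair

/-! ### Diagrams in the derived category -/

namespace HRS

open DerivedCategory

variable (I : Type u') [Category.{v'} I] (A : Type u) [Category.{v} A] [Abelian A]
  [HasDerivedCategory.{w} A]

/-- The functor which sends a complex of diagrams to the corresponding diagram in the derived
category. -/
noncomputable abbrev complexToDiagram : CochainComplex (I ⥤ A) ℤ ⥤ I ⥤ DerivedCategory A :=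
  HomologicalComplex.complexOfFunctorsToFunctorToComplex ⋙ (Functor.whiskeringRight I _ _).obj Q

variable {I A} in
lemma quasiIso_iff_isIso_complexToDiagram_map {K L : CochainComplex (I ⥤ A) ℤ} (f : K ⟶ L) :
    QuasiIso f ↔ IsIso ((complexToDiagram I A).map f) := by
  rw [HomologicalComplex.quasiIso_iff_evaluation, NatTrans.isIso_iff_isIso_app]
  exact forall_congr' fun i ↦ (isIso_Q_map_iff_quasiIso _ _).symm

lemma complexToDiagram_inverts_quasiIso :
    (HomologicalComplex.quasiIso (I ⥤ A) (ComplexShape.up ℤ)).IsInvertedBy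
      (complexToDiagram I A) :=
  fun _ _ f hf ↦ (quasiIso_iff_isIso_complexToDiagram_map f).1 hf

variable [HasDerivedCategory.{w'} (I ⥤ A)]

/-- The functor which sends an object of the derived category of the category of diagrams to the
diagram of its evaluations. -/
noncomputable def derivedToDiagram : DerivedCategory (I ⥤ A) ⥤ I ⥤ DerivedCategory A :=
  Localization.lift (complexToDiagram I A) (complexToDiagram_inverts_quasiIso I A) Q

noncomputable def derivedToDiagramFactors : Q ⋙ derivedToDiagram I A ≅ complexToDiagram I A :=
  Localization.fac _ _ _

variable {I A} in
lemma derivedToDiagram_map_Q_map {K L : CochainComplex (I ⥤ A) ℤ} (f : K ⟶ L) :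
    (derivedToDiagram I A).map (Q.map f) ≫ (derivedToDiagramFactors I A).hom.app L =
      (derivedToDiagramFactors I A).hom.app K ≫ (complexToDiagram I A).map f :=
  (derivedToDiagramFactors I A).hom.naturality f

/-- The evaluation at `i` of an object of the derived category of a category of diagrams. -/
noncomputable abbrev derivedEval (i : I) : DerivedCategory (I ⥤ A) ⥤ DerivedCategory A :=
  derivedToDiagram I A ⋙ (evaluation I _).obj i

noncomputable instance (i : I) : InducedBy ((evaluation I A).obj i) (derivedEval I A i) where
  iso := (Functor.isoWhiskerRight (derivedToDiagramFactors I A) ((evaluation I _).obj i)).symm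

noncomputable def derivedEvalIso (i : I) :
    derivedEval I A i ≅ ((evaluation I A).obj i).mapDerivedCategory :=
  letI : Localization.Lifting Q (HomologicalComplex.quasiIso (I ⥤ A) (ComplexShape.up ℤ))
      (((evaluation I A).obj i).mapHomologicalComplex (ComplexShape.up ℤ) ⋙ Q)
      (derivedEval I A i) :=
    ⟨(CatCommSq.iso (((evaluation I A).obj i).mapHomologicalComplex (ComplexShape.up ℤ)) Q Q
      (derivedEval I A i)).symm⟩
  Localization.liftNatIso Q (HomologicalComplex.quasiIso (I ⥤ A) (ComplexShape.up ℤ))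
    (((evaluation I A).obj i).mapHomologicalComplex (ComplexShape.up ℤ) ⋙ Q)
    (((evaluation I A).obj i).mapHomologicalComplex (ComplexShape.up ℤ) ⋙ Q) _ _ (Iso.refl _)

instance (i : I) : (derivedEval I A i).Additive :=
  Functor.additive_of_iso (derivedEvalIso I A i).symm

instance : (derivedToDiagram I A).Additive where
  map_add {X Y f g} := by
    ext i
    exact (derivedEval I A i).map_add

variable {I A} in
lemma isZero_of_isZero_derivedEval (X : DerivedCategory (I ⥤ A))
    (hX : ∀ i, IsZero ((derivedEval I A i).obj X)) : IsZero X :=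
  isZero_of_isZero_homology X fun n ↦ Functor.isZero _ fun i ↦
    (Functor.map_isZero (homologyFunctor A n) (hX i)).of_iso
      (homologyObjIso ((evaluation I A).obj i) (derivedEval I A i) X n).symm

end HRS

/-! ### Families of objects in the derived category -/

namespace HRS

section

variable {C D E : Type*} [Category* C] [Category* D] [Category* E] (L : C ⥤ D) [L.EssSurj]
  (F : D ⥤ E)

lemma full_of_essSurj (h : ∀ ⦃X Y : C⦄ (g : F.obj (L.obj X) ⟶ F.obj (L.obj Y)), ∃ f, F.map f = g) :
    F.Full where
  map_surjective {X Y} g := by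
    obtain ⟨f, hf⟩ := h (F.map (L.objObjPreimageIso X).hom ≫ g ≫ F.map (L.objObjPreimageIso Y).inv)
    refine ⟨(L.objObjPreimageIso X).inv ≫ f ≫ (L.objObjPreimageIso Y).hom, ?_⟩
    simp only [Functor.map_comp, hf, Category.assoc]
    simp [← Functor.map_comp, ← Functor.map_comp_assoc]

lemma faithful_of_essSurj [Preadditive D] [Preadditive E] [F.Additive]
    (h : ∀ ⦃X Y : C⦄ (f : L.obj X ⟶ L.obj Y), F.map f = 0 → f = 0) : F.Faithful where
  map_injective {X Y} f g hfg := by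
    have hz := h ((L.objObjPreimageIso X).hom ≫ (f - g) ≫ (L.objObjPreimageIso Y).inv)
      (by simp [hfg])
    rwa [Preadditive.IsIso.comp_left_eq_zero, Preadditive.IsIso.comp_right_eq_zero,
      sub_eq_zero] at hz

end

open DerivedCategory

variable {S : Type u''} {A : Type u} [Category.{v} A] [Abelian A]

/-- A family of complexes, as a complex in the category of families. -/
@[simps]
def familyComplex (K : S → CochainComplex A ℤ) : CochainComplex (Discrete S ⥤ A) ℤ where
  X n := Discrete.functor fun s ↦ (K s).X n
  d i j := Discrete.natTrans fun s ↦ (K s.as).d i j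
  shape i j h := by
    ext ⟨s⟩
    exact (K s).shape i j h

/-- The morphism from `familyComplex K` which corresponds to a family of morphisms. -/
@[simps]
def familyComplexDesc (K : S → CochainComplex A ℤ) {L : CochainComplex (Discrete S ⥤ A) ℤ}
    (f : ∀ s, K s ⟶ (((evaluation _ A).obj ⟨s⟩).mapHomologicalComplex (ComplexShape.up ℤ)).obj L) :
    familyComplex K ⟶ L where
  f n := Discrete.natTrans fun s ↦ (f s.as).f n
  comm' i j _ := by
    ext ⟨s⟩
    exact (f s).comm i j

lemma nonempty_homotopy_zero_of_discrete {K L : CochainComplex (Discrete S ⥤ A) ℤ} (f : K ⟶ L)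
    (h : ∀ s, Nonempty (Homotopy ((((evaluation _ A).obj s).mapHomologicalComplex
      (ComplexShape.up ℤ)).map f) 0)) : Nonempty (Homotopy f 0) := by
  replace h := fun s ↦ (h s).some
  exact ⟨
    { hom := fun i j ↦ Discrete.natTrans fun s ↦ (h s).hom i j
      zero := fun i j hij ↦ by
        ext s
        exact (h s).zero i j hij
      comm := fun i ↦ by
        ext s
        exact (h s).comm i }⟩

variable [HasDerivedCategory.{w} A]

lemma exists_quasiIso_homotopy_zero {K L : CochainComplex A ℤ} (f : K ⟶ L)
    (hf : Q.map f = 0) :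
    ∃ (K' : CochainComplex A ℤ) (s : K' ⟶ K), QuasiIso s ∧ Nonempty (Homotopy (s ≫ f) 0) := by
  have hf' : Qh.map ((HomotopyCategory.quotient _ _).map f) = Qh.map 0 := by
    rw [← cancel_mono ((quotientCompQhIso A).hom.app L), quotientCompQhIso_hom_naturality, hf]
    simp
  obtain ⟨K', s, hs, h⟩ := (MorphismProperty.map_eq_iff_precomp Qh
    (HomotopyCategory.quasiIso A (ComplexShape.up ℤ)) _ _).1 hf'
  obtain ⟨K', rfl⟩ := HomotopyCategory.quotient_obj_surjective K'
  obtain ⟨s, rfl⟩ := (HomotopyCategory.quotient _ _).map_surjective s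
  refine ⟨K', s, (HomotopyCategory.quotient_map_mem_quasiIso_iff s).1 hs,
    ⟨HomotopyCategory.homotopyOfEq _ _ ?_⟩⟩
  rw [Functor.map_comp, h, comp_zero, Functor.map_zero]

lemma quasiIso_familyComplexDesc (K : S → CochainComplex A ℤ)
    {L : CochainComplex (Discrete S ⥤ A) ℤ}
    (f : ∀ s, K s ⟶ (((evaluation _ A).obj ⟨s⟩).mapHomologicalComplex (ComplexShape.up ℤ)).obj L)
    (hf : ∀ s, IsIso (Q.map (f s))) : QuasiIso (familyComplexDesc K f) := by
  rw [quasiIso_iff_isIso_complexToDiagram_map, NatTrans.isIso_iff_isIso_app]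
  exact fun s ↦ hf s.as

variable [HasDerivedCategory.{w'} (Discrete S ⥤ A)]

lemma derivedToDiagram_discrete_map_surjective {K L : CochainComplex (Discrete S ⥤ A) ℤ}
    (ψ : (derivedToDiagram _ A).obj (Q.obj K) ⟶ (derivedToDiagram _ A).obj (Q.obj L)) :
    ∃ f : Q.obj K ⟶ Q.obj L, (derivedToDiagram _ A).map f = ψ := by
  let φ : (complexToDiagram _ A).obj K ⟶ (complexToDiagram _ A).obj L :=
    (derivedToDiagramFactors _ A).inv.app K ≫ ψ ≫ (derivedToDiagramFactors _ A).hom.app L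
  choose K' σ hσ g hg using fun s ↦ right_fac (φ.app ⟨s⟩)
  let σ' : familyComplex K' ⟶ K := familyComplexDesc K' σ
  let g' : familyComplex K' ⟶ L := familyComplexDesc K' g
  have : QuasiIso σ' := quasiIso_familyComplexDesc K' σ hσ
  have hφ : (complexToDiagram _ A).map σ' ≫ φ = (complexToDiagram _ A).map g' := by
    ext s
    change Q.map (σ s.as) ≫ φ.app s = Q.map (g s.as)
    rw [show φ.app s = _ from hg s.as]
    simp
  refine ⟨inv (Q.map σ') ≫ Q.map g', ?_⟩
  have hψ : (derivedToDiagram _ A).map (Q.map σ') ≫ ψ =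
      (derivedToDiagram _ A).map (Q.map g') := by
    rw [← cancel_mono ((derivedToDiagramFactors _ A).hom.app L), derivedToDiagram_map_Q_map, ← hφ,
      ← Category.assoc, ← derivedToDiagram_map_Q_map]
    simp [φ]
  rw [← cancel_epi ((derivedToDiagram _ A).map (Q.map σ')), hψ, ← Functor.map_comp,
    IsIso.hom_inv_id_assoc]

lemma Q_map_eq_zero_of_derivedToDiagram_discrete_map {K L : CochainComplex (Discrete S ⥤ A) ℤ}
    (g : K ⟶ L) (hg : (derivedToDiagram _ A).map (Q.map g) = 0) : Q.map g = 0 := by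
  have hg' : (complexToDiagram (Discrete S) A).map g = 0 := by
    rw [← cancel_epi ((derivedToDiagramFactors (Discrete S) A).hom.app K),
      ← derivedToDiagram_map_Q_map, hg, zero_comp, comp_zero]
  choose K' σ hσ hh using fun s ↦ exists_quasiIso_homotopy_zero _ (NatTrans.congr_app hg' ⟨s⟩)
  let σ' : familyComplex K' ⟶ K := familyComplexDesc K' σ
  have : QuasiIso σ' := quasiIso_familyComplexDesc K' σ fun s ↦
    (isIso_Q_map_iff_quasiIso _ _).2 (hσ s)
  obtain ⟨h⟩ := nonempty_homotopy_zero_of_discrete (σ' ≫ g) fun s ↦ hh s.as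
  rw [← cancel_epi (Q.map σ'), ← Functor.map_comp, Q_map_eq_of_homotopy _ h, Functor.map_zero,
    comp_zero]

instance : (derivedToDiagram (Discrete S) A).Full :=
  full_of_essSurj Q _ fun _ _ ↦ derivedToDiagram_discrete_map_surjective

instance : (derivedToDiagram (Discrete S) A).Faithful := by
  refine faithful_of_essSurj Q _ fun K L f hf ↦ ?_
  obtain ⟨K', s, hs, g, rfl⟩ := right_fac f
  have hg : (derivedToDiagram (Discrete S) A).map (Q.map g) = 0 := by
    simpa [Preadditive.IsIso.comp_left_eq_zero] using hf
  rw [Q_map_eq_zero_of_derivedToDiagram_discrete_map g hg, comp_zero]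

instance : (derivedToDiagram (Discrete S) A).EssSurj where
  mem_essImage M :=
    ⟨Q.obj (familyComplex fun s ↦ Q.objPreimage (M.obj ⟨s⟩)),
      ⟨(derivedToDiagramFactors _ A).app _ ≪≫
        Discrete.natIso fun s ↦ Q.objObjPreimageIso (M.obj s)⟩⟩

end HRS

/-! ### Torsion pairs in functor categories -/

namespace HRS

section

variable {I : Type u'} [Category.{v'} I] {A : Type u} [Category.{v} A] [Abelian A]

lemma exact_of_evaluation (S : ShortComplex (I ⥤ A))
    (h : ∀ i, (S.map ((evaluation I A).obj i)).Exact) : S.Exact := by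
  rw [ShortComplex.exact_iff_isZero_homology, Functor.isZero_iff]
  exact fun i ↦ ((ShortComplex.exact_iff_isZero_homology _).1 (h i)).of_iso
    (S.mapHomologyIso ((evaluation I A).obj i)).symm

lemma shortExact_of_evaluation (S : ShortComplex (I ⥤ A))
    (h : ∀ i, (S.map ((evaluation I A).obj i)).ShortExact) : S.ShortExact where
  exact := exact_of_evaluation S fun i ↦ (h i).exact
  mono_f := by
    have (i : I) : Mono (S.f.app i) := (h i).mono_f
    exact NatTrans.mono_of_mono_app _
  epi_g := by
    have (i : I) : Epi (S.g.app i) := (h i).epi_g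
    exact NatTrans.epi_of_epi_app _

open DerivedCategory

variable [HasDerivedCategory.{w} A] [HasDerivedCategory.{w'} (I ⥤ A)]

lemma isLE_iff_derivedEval (X : DerivedCategory (I ⥤ A)) (n : ℤ) :
    X.IsLE n ↔ ∀ i, ((derivedEval I A i).obj X).IsLE n := by
  refine ⟨fun h i ↦ isLE_obj_of_inducedBy ((evaluation I A).obj i) _ X n h, fun h ↦ ?_⟩
  rw [isLE_iff]
  exact fun k hk ↦ Functor.isZero _ fun i ↦ ((isLE_iff _ _).1 (h i) k hk).of_iso
    (homologyObjIso ((evaluation I A).obj i) (derivedEval I A i) X k).symm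

lemma isGE_iff_derivedEval (X : DerivedCategory (I ⥤ A)) (n : ℤ) :
    X.IsGE n ↔ ∀ i, ((derivedEval I A i).obj X).IsGE n := by
  refine ⟨fun h i ↦ isGE_obj_of_inducedBy ((evaluation I A).obj i) _ X n h, fun h ↦ ?_⟩
  rw [isGE_iff]
  exact fun k hk ↦ Functor.isZero _ fun i ↦ ((isGE_iff _ _).1 (h i) k hk).of_iso
    (homologyObjIso ((evaluation I A).obj i) (derivedEval I A i) X k).symm

end

end HRS

namespace TorsionPair

variable {A : Type u} [Category.{v} A] [Abelian A] (t : TorsionPair A)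

lemma torsion_iff (X : A) :
    t.torsion X ↔ ∀ ⦃Y : A⦄ (f : X ⟶ Y), t.torsionFree Y → f = 0 := by
  refine ⟨fun hX Y f hY ↦ t.hom_eq_zero f hX hY, fun h ↦ ?_⟩
  obtain ⟨T, F, i, p, w, hT, hF, hS⟩ := t.exists_shortExact X
  have := hS.mono_f
  have : Epi i := hS.exact.epi_f (h p hF)
  have := isIso_of_mono_of_epi i
  exact t.torsion.prop_of_iso (asIso i) hT

lemma torsionFree_iff (Y : A) :
    t.torsionFree Y ↔ ∀ ⦃X : A⦄ (f : X ⟶ Y), t.torsion X → f = 0 := by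
  refine ⟨fun hY X f hX ↦ t.hom_eq_zero f hX hY, fun h ↦ ?_⟩
  obtain ⟨T, F, i, p, w, hT, hF, hS⟩ := t.exists_shortExact Y
  have := hS.epi_g
  have : Mono p := hS.exact.mono_g (h i hT)
  have := isIso_of_mono_of_epi p
  exact t.torsionFree.prop_of_iso (asIso p).symm hF

lemma torsion_of_epi {X Y : A} (f : X ⟶ Y) [Epi f] (hX : t.torsion X) : t.torsion Y := by
  rw [torsion_iff]
  intro Z g hZ
  rw [← cancel_epi f, t.hom_eq_zero (f ≫ g) hX hZ, comp_zero]

lemma torsionFree_of_mono {X Y : A} (f : X ⟶ Y) [Mono f] (hY : t.torsionFree Y) :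
    t.torsionFree X := by
  rw [torsionFree_iff]
  intro Z g hZ
  rw [← cancel_mono f, t.hom_eq_zero (g ≫ f) hZ hY, zero_comp]

instance (J : Type u') [Category.{v'} J] : t.torsion.IsClosedUnderColimitsOfShape J where
  colimitsOfShape_le X := by
    rintro ⟨h⟩
    rw [torsion_iff]
    intro Z g hZ
    exact h.isColimit.hom_ext fun j ↦ by
      rw [comp_zero]
      exact t.hom_eq_zero _ (h.prop_diag_obj j) hZ

instance (J : Type u') [Category.{v'} J] : t.torsionFree.IsClosedUnderLimitsOfShape J where
  limitsOfShape_le X := by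
    rintro ⟨h⟩
    rw [torsionFree_iff]
    intro Z g hZ
    exact h.isLimit.hom_ext fun j ↦ by
      rw [zero_comp]
      exact t.hom_eq_zero _ hZ (h.prop_diag_obj j)

/-- The torsion part of an object. -/
noncomputable def torsionPart (X : A) : A := (t.exists_shortExact X).choose

/-- The torsion-free part of an object. -/
noncomputable def freePart (X : A) : A := (t.exists_shortExact X).choose_spec.choose

/-- The inclusion of the torsion part of an object. -/
noncomputable def torsionPartι (X : A) : t.torsionPart X ⟶ X :=
  (t.exists_shortExact X).choose_spec.choose_spec.choose

/-- The projection to the torsion-free part of an object. -/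
noncomputable def freePartπ (X : A) : X ⟶ t.freePart X :=
  (t.exists_shortExact X).choose_spec.choose_spec.choose_spec.choose

lemma torsionPartι_freePartπ (X : A) : t.torsionPartι X ≫ t.freePartπ X = 0 :=
  (t.exists_shortExact X).choose_spec.choose_spec.choose_spec.choose_spec.choose

lemma torsion_torsionPart (X : A) : t.torsion (t.torsionPart X) :=
  (t.exists_shortExact X).choose_spec.choose_spec.choose_spec.choose_spec.choose_spec.1

lemma torsionFree_freePart (X : A) : t.torsionFree (t.freePart X) :=
  (t.exists_shortExact X).choose_spec.choose_spec.choose_spec.choose_spec.choose_spec.2.1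

lemma shortExact_torsionPart (X : A) :
    (ShortComplex.mk _ _ (t.torsionPartι_freePartπ X)).ShortExact :=
  (t.exists_shortExact X).choose_spec.choose_spec.choose_spec.choose_spec.choose_spec.2.2

instance (X : A) : Mono (t.torsionPartι X) := (t.shortExact_torsionPart X).mono_f

instance (X : A) : Epi (t.freePartπ X) := (t.shortExact_torsionPart X).epi_g

lemma exists_torsionPart_map {X Y : A} (f : X ⟶ Y) :
    ∃ g : t.torsionPart X ⟶ t.torsionPart Y, g ≫ t.torsionPartι Y = t.torsionPartι X ≫ f := by
  have : Mono (ShortComplex.mk _ _ (t.torsionPartι_freePartπ Y)).f :=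
    inferInstanceAs (Mono (t.torsionPartι Y))
  exact ⟨(t.shortExact_torsionPart Y).exact.lift (t.torsionPartι X ≫ f)
    (t.hom_eq_zero _ (t.torsion_torsionPart X) (t.torsionFree_freePart Y)),
    (t.shortExact_torsionPart Y).exact.lift_f _ _⟩

lemma exists_freePart_map {X Y : A} (f : X ⟶ Y) :
    ∃ g : t.freePart X ⟶ t.freePart Y, t.freePartπ X ≫ g = f ≫ t.freePartπ Y := by
  have : Epi (ShortComplex.mk _ _ (t.torsionPartι_freePartπ X)).g :=
    inferInstanceAs (Epi (t.freePartπ X))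
  exact ⟨(t.shortExact_torsionPart X).exact.desc (f ≫ t.freePartπ Y)
    (t.hom_eq_zero _ (t.torsion_torsionPart X) (t.torsionFree_freePart Y)),
    (t.shortExact_torsionPart X).exact.g_desc _ _⟩

/-- The torsion radical as a functor. -/
@[simps obj]
noncomputable def torsionFunctor : A ⥤ A where
  obj := t.torsionPart
  map f := (t.exists_torsionPart_map f).choose
  map_id X := by
    rw [← cancel_mono (t.torsionPartι X), (t.exists_torsionPart_map _).choose_spec]
    simp
  map_comp {X Y Z} f g := by
    rw [← cancel_mono (t.torsionPartι Z), (t.exists_torsionPart_map _).choose_spec, Category.assoc,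
      (t.exists_torsionPart_map g).choose_spec, ← Category.assoc, ← Category.assoc,
      (t.exists_torsionPart_map f).choose_spec]

/-- The torsion-free quotient as a functor. -/
@[simps obj]
noncomputable def freeFunctor : A ⥤ A where
  obj := t.freePart
  map f := (t.exists_freePart_map f).choose
  map_id X := by
    rw [← cancel_epi (t.freePartπ X), (t.exists_freePart_map _).choose_spec]
    simp
  map_comp {X Y Z} f g := by
    rw [← cancel_epi (t.freePartπ X), (t.exists_freePart_map _).choose_spec, ← Category.assoc,
      (t.exists_freePart_map f).choose_spec, Category.assoc, Category.assoc,
      (t.exists_freePart_map g).choose_spec]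

/-- The inclusion of the torsion radical. -/
@[simps]
noncomputable def torsionFunctorι : t.torsionFunctor ⟶ 𝟭 A where
  app := t.torsionPartι
  naturality _ _ f := (t.exists_torsionPart_map f).choose_spec

/-- The projection to the torsion-free quotient. -/
@[simps]
noncomputable def freeFunctorπ : 𝟭 A ⟶ t.freeFunctor where
  app := t.freePartπ
  naturality _ _ f := (t.exists_freePart_map f).choose_spec.symm

/-- The short complex formed by the torsion part and the torsion-free part of a functor. -/
@[simps]
noncomputable def functorShortComplex {I : Type u'} [Category.{v'} I] (X : I ⥤ A) :
    ShortComplex (I ⥤ A) where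
  X₁ := X ⋙ t.torsionFunctor
  X₂ := X
  X₃ := X ⋙ t.freeFunctor
  f := Functor.whiskerLeft X t.torsionFunctorι
  g := Functor.whiskerLeft X t.freeFunctorπ
  zero := by
    ext i
    exact t.torsionPartι_freePartπ (X.obj i)

lemma functorShortComplex_shortExact {I : Type u'} [Category.{v'} I] (X : I ⥤ A) :
    (t.functorShortComplex X).ShortExact :=
  HRS.shortExact_of_evaluation _ fun i ↦ t.shortExact_torsionPart (X.obj i)

/-- The torsion pair in a functor category whose classes are defined pointwise. -/
def functorCategory (I : Type u') [Category.{v'} I] : TorsionPair (I ⥤ A) where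
  torsion X := ∀ i, t.torsion (X.obj i)
  torsionFree X := ∀ i, t.torsionFree (X.obj i)
  torsion_iso := ⟨fun e h i ↦ t.torsion.prop_of_iso (e.app i) (h i)⟩
  torsionFree_iso := ⟨fun e h i ↦ t.torsionFree.prop_of_iso (e.app i) (h i)⟩
  hom_eq_zero X Y f hX hY := by
    ext i
    exact t.hom_eq_zero _ (hX i) (hY i)
  exists_shortExact X := ⟨_, _, _, _, _, fun i ↦ t.torsion_torsionPart (X.obj i),
    fun i ↦ t.torsionFree_freePart (X.obj i), t.functorShortComplex_shortExact X⟩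

open DerivedCategory HRS

variable [HasDerivedCategory.{w} A] {I : Type u'} [Category.{v'} I]
  [HasDerivedCategory.{w'} (I ⥤ A)]

lemma functorCategory_heart_iff (X : DerivedCategory (I ⥤ A)) :
    (t.functorCategory I).tStructure.heart X ↔
      ∀ i, t.tStructure.heart ((derivedEval I A i).obj X) := by
  refine ⟨fun hX i ↦ heart_obj_of_inducedBy (t.functorCategory I) t ((evaluation I A).obj i)
    (derivedEval I A i) (fun _ h ↦ h i) (fun _ h ↦ h i) X hX, fun h ↦ ?_⟩
  let e (i : I) (n : ℤ) := homologyObjIso ((evaluation I A).obj i) (derivedEval I A i) X n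
  rw [mem_heart_iff, isLE_iff_derivedEval, isGE_iff_derivedEval]
  simp only [mem_heart_iff] at h
  exact ⟨⟨fun i ↦ (h i).1.1, fun i ↦ t.torsion.prop_of_iso (e i 0) (h i).1.2⟩,
    ⟨fun i ↦ (h i).2.1, fun i ↦ t.torsionFree.prop_of_iso (e i (-1)) (h i).2.2⟩⟩

variable (I)

/-- The functor from the heart of a pointwise torsion pair to diagrams in the heart. -/
@[simps]
noncomputable def heartToDiagram : (t.functorCategory I).Heart ⥤ I ⥤ t.Heart where
  obj X := t.tStructure.heart.lift ((derivedToDiagram I A).obj X.obj)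
    ((t.functorCategory_heart_iff X.obj).1 X.property)
  map f :=
    { app i := ObjectProperty.homMk (((derivedToDiagram I A).map f.hom).app i)
      naturality i j g := by
        ext
        exact ((derivedToDiagram I A).map f.hom).naturality g }

instance : (t.heartToDiagram I).Additive where
  map_add {X Y f g} := by
    ext i
    exact (derivedEval I A i).map_add

lemma isZero_of_isZero_heartToDiagram (X : (t.functorCategory I).Heart)
    (h : ∀ i, IsZero (((t.heartToDiagram I).obj X).obj i)) : IsZero X := by
  have : IsZero X.obj :=
    isZero_of_isZero_derivedEval _ fun i ↦ t.tStructure.heart.ι.map_isZero (h i)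
  rw [IsZero.iff_id_eq_zero]
  ext
  exact this.eq_of_src _ _

section

variable [(derivedToDiagram I A).Full]

instance : (t.heartToDiagram I).Full where
  map_surjective {X Y} φ := by
    obtain ⟨f, hf⟩ := (derivedToDiagram I A).map_surjective
      (X := X.obj) (Y := Y.obj) (Functor.whiskerRight φ t.tStructure.heart.ι)
    refine ⟨ObjectProperty.homMk f, ?_⟩
    ext i
    exact NatTrans.congr_app hf i

end

instance [(derivedToDiagram I A).Faithful] : (t.heartToDiagram I).Faithful where
  map_injective {X Y} f g h := by
    ext
    apply (derivedToDiagram I A).map_injective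
    ext i
    exact congr_arg (fun φ ↦ (φ.app i).hom) h

instance [(derivedToDiagram I A).EssSurj] : (t.heartToDiagram I).EssSurj where
  mem_essImage M := by
    let e := (derivedToDiagram I A).objObjPreimageIso (M ⋙ t.tStructure.heart.ι)
    refine ⟨⟨(derivedToDiagram I A).objPreimage (M ⋙ t.tStructure.heart.ι),
      (t.functorCategory_heart_iff _).2 fun i ↦
        t.tStructure.heart.prop_of_iso (e.app i).symm (M.obj i).property⟩,
      ⟨NatIso.ofComponents (fun i ↦ t.tStructure.heart.isoMk (e.app i)) fun f ↦ ?_⟩⟩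
    ext
    exact e.hom.naturality f

end TorsionPair

/-! ### Exact sequences and colimits in the heart -/

namespace HRS

section

variable {C : Type u} [Category.{v} C] [Preadditive C] [HasZeroObject C] [HasShift C ℤ]
  [∀ (n : ℤ), (shiftFunctor C n).Additive] [Pretriangulated C]

lemma distTriang_of_iso₁ {X X' Y Z : C} {f : X ⟶ Y} {g : Y ⟶ Z} {h : Z ⟶ X⟦(1 : ℤ)⟧}
    (hT : Triangle.mk f g h ∈ distTriang C) (e : X ≅ X') :
    Triangle.mk (e.inv ≫ f) g (h ≫ e.hom⟦(1 : ℤ)⟧') ∈ distTriang C :=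
  isomorphic_distinguished _ hT _ (Triangle.isoMk _ _ e.symm (Iso.refl _) (Iso.refl _)
    (Category.comp_id _) ((Category.comp_id _).trans (Category.id_comp _).symm)
    ((by simp : (h ≫ e.hom⟦(1 : ℤ)⟧') ≫ e.inv⟦(1 : ℤ)⟧' = h).trans (Category.id_comp _).symm))

lemma distTriang_of_iso₃ {X Y Z Z' : C} {f : X ⟶ Y} {g : Y ⟶ Z} {h : Z ⟶ X⟦(1 : ℤ)⟧}
    (hT : Triangle.mk f g h ∈ distTriang C) (e : Z ≅ Z') {g' : Y ⟶ Z'} (hg : g ≫ e.hom = g') :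
    Triangle.mk f g' (e.inv ≫ h) ∈ distTriang C :=
  isomorphic_distinguished _ hT _ (Triangle.isoMk _ _ (Iso.refl _) (Iso.refl _) e.symm
    ((Category.comp_id _).trans (Category.id_comp _).symm)
    ((by simp [← hg] : g' ≫ e.inv = g).trans (Category.id_comp _).symm)
    ((congr_arg _ (CategoryTheory.Functor.map_id _ _)).trans (Category.comp_id _)))

variable [IsTriangulated C] (t : TStructure C) (S : ShortComplex t.heart.FullSubcategory)

lemma shortExact_of_distTriang_heart (h : S.X₃.obj ⟶ S.X₁.obj⟦(1 : ℤ)⟧)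
    (hT : Triangle.mk S.f.hom S.g.hom h ∈ distTriang C) : S.ShortExact := by
  have h₁ := AbelianSubcategory.isLimitKernelForkOfDistTriang (ι := t.heart.ι)
    t.heart_hom_shift_eq_zero S.f S.g h hT
  have h₂ := AbelianSubcategory.isColimitCokernelCoforkOfDistTriang (ι := t.heart.ι)
    t.heart_hom_shift_eq_zero S.f S.g h hT
  exact
    { exact := S.exact_of_f_is_kernel h₁
      mono_f := mono_of_isLimit_fork h₁
      epi_g := epi_of_isColimit_cofork h₂ }

lemma exists_distTriang_of_shortExact_heart (hS : S.ShortExact) :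
    ∃ h : S.X₃.obj ⟶ S.X₁.obj⟦(1 : ℤ)⟧, Triangle.mk S.f.hom S.g.hom h ∈ distTriang C := by
  have := hS.mono_f
  have := hS.epi_g
  obtain ⟨X₃, f₂, f₃, hT⟩ := distinguished_cocone_triangle S.f.hom
  -- the cone of `S.f` is an extension of the cokernel `Q` by the shift of the kernel `K = 0`
  obtain ⟨K, Q, α, β, γ, hT'⟩ := (show AbelianSubcategory.admissibleMorphism t.heart.ι S.f by
    rw [t.heart_admissibleMorphism]; trivial) f₂ f₃ hT
  have hK : IsZero K := by
    have := AbelianSubcategory.mono_ιK (ι := t.heart.ι) t.heart_hom_shift_eq_zero hT hT'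
    have h0 := AbelianSubcategory.ιK_mor₁ (ι := t.heart.ι) hT α
    rw [← zero_comp (f := S.f), cancel_mono] at h0
    exact IsZero.of_mono_eq_zero _ h0
  have hβ : IsIso β := (Triangle.isZero₁_iff_isIso₂ _ hT').1
    (Functor.map_isZero (shiftFunctor C (1 : ℤ)) (t.heart.ι.map_isZero hK))
  have hc := AbelianSubcategory.isColimitCokernelCofork (ι := t.heart.ι)
    t.heart_hom_shift_eq_zero hT hT'
  let e : Q ≅ S.X₃ := hc.coconePointUniqueUpToIso hS.exact.gIsCokernel
  have he : f₂ ≫ β ≫ e.hom.hom = S.g.hom := by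
    rw [← Category.assoc, ← AbelianSubcategory.ι_map_πQ (ι := t.heart.ι) f₂ β]
    exact congr_arg t.heart.ι.map
      (hc.comp_coconePointUniqueUpToIso_hom hS.exact.gIsCokernel WalkingParallelPair.one)
  exact ⟨_, distTriang_of_iso₃ hT (asIso β ≪≫ t.heart.ι.mapIso e) he⟩

end

end HRS

namespace TorsionPair

open DerivedCategory HRS

section

variable {A : Type u} [Category.{v} A] [Abelian A] {B : Type u'} [Category.{v'} B] [Abelian B]
  [HasDerivedCategory.{w} A] [HasDerivedCategory.{w'} B] {t : TorsionPair A} {s : TorsionPair B}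
  (Φ' : DerivedCategory A ⥤ DerivedCategory B) [Φ'.CommShift ℤ] [Φ'.IsTriangulated]
  (hΦ : ∀ X, t.tStructure.heart X → s.tStructure.heart (Φ'.obj X))

instance : (heartFunctor Φ' hΦ).Additive where
  map_add {X Y f g} := by
    ext
    exact Φ'.map_add

lemma shortExact_map_heartFunctor (S : ShortComplex t.Heart) (hS : S.ShortExact) :
    (S.map (heartFunctor Φ' hΦ)).ShortExact := by
  obtain ⟨h, hT⟩ := exists_distTriang_of_shortExact_heart t.tStructure S hS
  exact shortExact_of_distTriang_heart s.tStructure _ _ (Φ'.map_distinguished _ hT)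

lemma preservesFiniteLimits_heartFunctor : PreservesFiniteLimits (heartFunctor Φ' hΦ) :=
  ((heartFunctor Φ' hΦ).exact_tfae.out 0 3 :).1 (shortExact_map_heartFunctor Φ' hΦ) |>.1

end

variable {A : Type u} [Category.{v} A] [Abelian A] (t : TorsionPair A)
  (I : Type u') [Category.{v'} I]

instance : (Functor.const I : A ⥤ I ⥤ A).Additive where

variable [HasDerivedCategory.{w} A] [HasDerivedCategory.{w'} (I ⥤ A)]

noncomputable def derivedToDiagramConstIso :
    (Functor.const I : A ⥤ I ⥤ A).mapDerivedCategory ⋙ derivedToDiagram I A ≅ Functor.const I :=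
  letI : Localization.Lifting Q (HomologicalComplex.quasiIso A (ComplexShape.up ℤ))
      ((Functor.const I : A ⥤ I ⥤ A).mapHomologicalComplex (ComplexShape.up ℤ) ⋙
        complexToDiagram I A)
      ((Functor.const I : A ⥤ I ⥤ A).mapDerivedCategory ⋙ derivedToDiagram I A) :=
    ⟨(Functor.associator _ _ _).symm ≪≫
      Functor.isoWhiskerRight (Functor.const I).mapDerivedCategoryFactors _ ≪≫
      Functor.associator _ _ _ ≪≫ Functor.isoWhiskerLeft _ (derivedToDiagramFactors I A)⟩
  letI : Localization.Lifting Q (HomologicalComplex.quasiIso A (ComplexShape.up ℤ))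
      (Q ⋙ Functor.const I : CochainComplex A ℤ ⥤ I ⥤ DerivedCategory A) (Functor.const I) :=
    ⟨Iso.refl _⟩
  Localization.liftNatIso Q (HomologicalComplex.quasiIso A (ComplexShape.up ℤ))
    ((Functor.const I : A ⥤ I ⥤ A).mapHomologicalComplex (ComplexShape.up ℤ) ⋙
        complexToDiagram I A)
    (Q ⋙ Functor.const I : CochainComplex A ℤ ⥤ I ⥤ DerivedCategory A) _ _
    (NatIso.ofComponents (fun K ↦ NatIso.ofComponents (fun i ↦ Iso.refl _)
      (fun f ↦ by
        refine (Category.comp_id _).trans ((Q.map_id _).trans (Category.id_comp _).symm)))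
      (fun f ↦ by
        ext i
        exact (Category.comp_id _).trans (Category.id_comp _).symm))

lemma heart_const (X : DerivedCategory A) (hX : t.tStructure.heart X) :
    (t.functorCategory I).tStructure.heart ((Functor.const I).mapDerivedCategory.obj X) :=
  heart_obj_of_inducedBy t (t.functorCategory I) (Functor.const I) _ (fun _ h _ ↦ h)
    (fun _ h _ ↦ h) X hX

/-- The constant diagram functor for the hearts. -/
noncomputable abbrev heartConst : t.Heart ⥤ (t.functorCategory I).Heart :=
  heartFunctor (Functor.const I).mapDerivedCategory (t.heart_const I)

noncomputable def heartToDiagramConstIso :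
    t.heartConst I ⋙ t.heartToDiagram I ≅ Functor.const I :=
  NatIso.ofComponents (fun X ↦ NatIso.ofComponents
    (fun i ↦ t.tStructure.heart.isoMk (((derivedToDiagramConstIso I).app X.obj).app i))
    (fun f ↦ by
      ext
      exact ((derivedToDiagramConstIso I).hom.app X.obj).naturality f))
    (fun f ↦ by
      ext i
      exact NatTrans.congr_app ((derivedToDiagramConstIso I).hom.naturality f.hom) i)

section

variable [HasColimitsOfShape I A] [HasExactColimitsOfShape I A]

instance : (colim : (I ⥤ A) ⥤ A).Additive :=
  Functor.additive_of_preserves_binary_products _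

variable [t.torsionFree.IsClosedUnderColimitsOfShape I]

lemma heart_colim (X : DerivedCategory (I ⥤ A)) (hX : (t.functorCategory I).tStructure.heart X) :
    t.tStructure.heart ((colim : (I ⥤ A) ⥤ A).mapDerivedCategory.obj X) :=
  heart_obj_of_inducedBy (t.functorCategory I) t colim _ (fun _ h ↦ t.torsion.prop_colimit _ h)
    (fun _ h ↦ t.torsionFree.prop_colimit _ h) X hX

/-- The colimit functor from the heart of the pointwise torsion pair. -/
noncomputable abbrev heartColim : (t.functorCategory I).Heart ⥤ t.Heart :=
  heartFunctor (colim : (I ⥤ A) ⥤ A).mapDerivedCategory (t.heart_colim I)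

noncomputable def heartColimAdj : t.heartColim I ⊣ t.heartConst I :=
  heartAdjunction (derivedAdjunction colimConstAdj _ _) _ _

variable [(t.heartToDiagram I).IsEquivalence]

noncomputable def heartDiagramColimAdj :
    (t.heartToDiagram I).inv ⋙ t.heartColim I ⊣ Functor.const I :=
  ((t.heartToDiagram I).asEquivalence.symm.toAdjunction.comp (t.heartColimAdj I)).ofNatIsoRight
    (t.heartToDiagramConstIso I)

lemma hasColimitsOfShape_heart : HasColimitsOfShape I t.Heart :=
  hasColimitsOfShape_iff_isRightAdjoint_const.2 ⟨_, ⟨t.heartDiagramColimAdj I⟩⟩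

lemma hasExactColimitsOfShape_heart [HasColimitsOfShape I t.Heart] :
    HasExactColimitsOfShape I t.Heart := by
  have := preservesFiniteLimits_heartFunctor (colim : (I ⥤ A) ⥤ A).mapDerivedCategory
    (t.heart_colim I)
  have : PreservesFiniteLimits ((t.heartToDiagram I).inv ⋙ t.heartColim I) :=
    comp_preservesFiniteLimits _ _
  exact ⟨preservesFiniteLimits_of_natIso
    ((t.heartDiagramColimAdj I).leftAdjointUniq colimConstAdj)⟩

end

end TorsionPair

/-! ### A criterion for a functor to a category of diagrams to be an equivalence -/

namespace HRS

/-- The data of left and right adjoints of the evaluations of a functor `E : K ⥤ I ⥤ H`, such that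
the value at `i` of the right adjoint at `j` is the identity if there is a morphism `i ⟶ j`, and
zero otherwise, as it is for diagrams indexed by a thin category. -/
structure EvaluationAdjunctions {I K H : Type*} [Category* I] [Category* K] [Category* H]
    [HasZeroMorphisms H] (E : K ⥤ I ⥤ H) where
  left (i : I) : H ⥤ K
  right (i : I) : H ⥤ K
  adjLeft (i : I) : left i ⊣ E ⋙ (evaluation I H).obj i
  adjRight (i : I) : E ⋙ (evaluation I H).obj i ⊣ right i
  isIso {i j : I} (f : i ⟶ j) (Z : H) :
    IsIso ((E.obj ((right j).obj Z)).map f ≫ (adjRight j).counit.app Z)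
  isZero {i j : I} (hij : IsEmpty (i ⟶ j)) (Z : H) : IsZero ((E.obj ((right j).obj Z)).obj i)

namespace EvaluationAdjunctions

variable {I K H : Type*} [Category* I] [Category* K] [Category* H] [Abelian H] {E : K ⥤ I ⥤ H}
  (h : EvaluationAdjunctions E)

lemma preservesFiniteColimits (h : EvaluationAdjunctions E) : PreservesFiniteColimits E :=
  preservesFiniteColimits_of_evaluation E fun i ↦
    have := (h.adjRight i).leftAdjoint_preservesColimits
    ⟨fun _ ↦ inferInstance⟩

variable [∀ (X : I → K), HasCoproduct X]

/-- The object of `K` which is freely generated by a family of objects. -/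
noncomputable def free (X : I → H) : K := ∐ fun i ↦ (h.left i).obj (X i)

/-- The generators of a free object. -/
noncomputable def gen (X : I → H) (i : I) : X i ⟶ (E.obj (h.free X)).obj i :=
  (h.adjLeft i).homEquiv _ _ (Sigma.ι (fun i ↦ (h.left i).obj (X i)) i)

variable {h} in
lemma gen_map {X : I → H} {Y : K} (p : h.free X ⟶ Y) (i : I) :
    h.gen X i ≫ (E.map p).app i =
      (h.adjLeft i).homEquiv _ _ (Sigma.ι (fun i ↦ (h.left i).obj (X i)) i ≫ p) :=
  ((h.adjLeft i).homEquiv_naturality_right _ _).symm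

variable {h} in
lemma free_hom_ext {X : I → H} {Y : K} {p q : h.free X ⟶ Y}
    (hpq : ∀ i, h.gen X i ≫ (E.map p).app i = h.gen X i ≫ (E.map q).app i) : p = q := by
  refine Sigma.hom_ext _ _ fun i ↦ ((h.adjLeft i).homEquiv _ _).injective ?_
  rw [← gen_map, ← gen_map, hpq]

lemma exists_free_desc {X : I → H} {Y : K} (y : ∀ i, X i ⟶ (E.obj Y).obj i) :
    ∃ p : h.free X ⟶ Y, ∀ i, h.gen X i ≫ (E.map p).app i = y i :=
  ⟨Sigma.desc fun i ↦ ((h.adjLeft i).homEquiv _ _).symm (y i), fun i ↦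
    (gen_map _ i).trans (by simp)⟩

variable {h} in
lemma gen_right {X : I → H} {j : I} {Z : H} (g : (E.obj (h.free X)).obj j ⟶ Z) {i : I} (f : i ⟶ j) :
    (h.gen X i ≫ (E.map ((h.adjRight j).homEquiv _ _ g)).app i) ≫
        (E.obj ((h.right j).obj Z)).map f ≫ (h.adjRight j).counit.app Z =
      h.gen X i ≫ (E.obj (h.free X)).map f ≫ g := by
  have h₁ := (h.adjRight j).homEquiv_counit (g := (h.adjRight j).homEquiv _ _ g)
  rw [Equiv.symm_apply_apply] at h₁
  conv_rhs => rw [h₁]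
  simp

variable {h} in
lemma free_obj_hom_ext {X : I → H} {j : I} {Z : H} {g g' : (E.obj (h.free X)).obj j ⟶ Z}
    (hg : ∀ (i : I) (f : i ⟶ j), h.gen X i ≫ (E.obj (h.free X)).map f ≫ g =
      h.gen X i ≫ (E.obj (h.free X)).map f ≫ g') : g = g' := by
  apply ((h.adjRight j).homEquiv (h.free X) Z).injective
  refine free_hom_ext fun i ↦ ?_
  by_cases hij : IsEmpty (i ⟶ j)
  · exact (h.isZero hij Z).eq_of_tgt _ _
  · obtain ⟨f⟩ := not_isEmpty_iff.1 hij
    have := h.isIso f Z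
    rw [← cancel_mono ((E.obj ((h.right j).obj Z)).map f ≫ (h.adjRight j).counit.app Z),
      gen_right, gen_right, hg]

lemma exists_free_obj_desc [Quiver.IsThin I] {X : I → H} {j : I} {Z : H}
    (y : ∀ (i : I) (_ : i ⟶ j), X i ⟶ Z) :
    ∃ g : (E.obj (h.free X)).obj j ⟶ Z, ∀ (i : I) (f : i ⟶ j),
      h.gen X i ≫ (E.obj (h.free X)).map f ≫ g = y i f := by
  classical
  have {i : I} (f : i ⟶ j) := h.isIso f Z
  obtain ⟨p, hp⟩ := h.exists_free_desc (X := X) (Y := (h.right j).obj Z) fun i ↦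
    if hij : Nonempty (i ⟶ j) then y i hij.some ≫
      inv ((E.obj ((h.right j).obj Z)).map hij.some ≫ (h.adjRight j).counit.app Z)
    else 0
  refine ⟨((h.adjRight j).homEquiv _ _).symm p, fun i f ↦ ?_⟩
  have hij : Nonempty (i ⟶ j) := ⟨f⟩
  rw [← gen_right, Equiv.apply_symm_apply, hp, dif_pos hij, Subsingleton.elim hij.some f]
  simp

variable {h} in
lemma map_free_hom_ext {X : I → H} {M : I ⥤ H} {φ ψ : E.obj (h.free X) ⟶ M}
    (hφ : ∀ i, h.gen X i ≫ φ.app i = h.gen X i ≫ ψ.app i) : φ = ψ := by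
  ext j
  refine free_obj_hom_ext fun i f ↦ ?_
  rw [φ.naturality, ψ.naturality, reassoc_of% hφ]

lemma exists_map_free_desc [Quiver.IsThin I] {X : I → H} {M : I ⥤ H} (m : ∀ i, X i ⟶ M.obj i) :
    ∃ φ : E.obj (h.free X) ⟶ M, ∀ i, h.gen X i ≫ φ.app i = m i := by
  choose φ hφ using fun j ↦ h.exists_free_obj_desc (X := X) (j := j) (Z := M.obj j)
    fun i f ↦ m i ≫ M.map f
  refine ⟨{ app := φ, naturality := fun j k a ↦ free_obj_hom_ext fun i f ↦ ?_ }, fun i ↦ ?_⟩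
  · rw [reassoc_of% hφ j i f, ← M.map_comp, ← hφ k i (f ≫ a)]
    simp
  · simpa using hφ i i (𝟙 i)

lemma exists_epi_map_free [Quiver.IsThin I] (M : I ⥤ H) :
    ∃ φ : E.obj (h.free M.obj) ⟶ M, Epi φ := by
  obtain ⟨φ, hφ⟩ := h.exists_map_free_desc fun i ↦ 𝟙 (M.obj i)
  have (i : I) : IsSplitEpi (φ.app i) := ⟨⟨_, hφ i⟩⟩
  exact ⟨φ, NatTrans.epi_of_epi_app φ⟩

variable [Abelian K] [E.Additive]

lemma exists_epi_free (hE : ∀ Y : K, (∀ i, IsZero ((E.obj Y).obj i)) → IsZero Y) (Y : K) :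
    ∃ p : h.free (E.obj Y).obj ⟶ Y,
      (∀ i, h.gen _ i ≫ (E.map p).app i = 𝟙 _) ∧ Epi p ∧ Epi (E.map p) := by
  obtain ⟨p, hp⟩ := h.exists_free_desc (X := (E.obj Y).obj) (fun i ↦ 𝟙 _)
  have := h.preservesFiniteColimits
  have (i : I) : IsSplitEpi ((E.map p).app i) := ⟨⟨_, hp i⟩⟩
  have h₁ : Epi (E.map p) := NatTrans.epi_of_epi_app _
  refine ⟨p, hp, ?_, h₁⟩
  refine Abelian.epi_of_cokernel_π_eq_zero _ ((hE _ fun i ↦ ?_).eq_of_tgt _ _)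
  have h₂ : E.map (cokernel.π p) = 0 := by
    rw [← cancel_epi (E.map p), ← E.map_comp, cokernel.condition, E.map_zero, comp_zero]
  have h₃ : IsZero (E.obj (cokernel p)) := IsZero.of_epi_eq_zero _ h₂
  exact (Functor.isZero_iff _).1 h₃ i

lemma faithful (h : EvaluationAdjunctions E)
    (hE : ∀ Y : K, (∀ i, IsZero ((E.obj Y).obj i)) → IsZero Y) : E.Faithful where
  map_injective {Y Y'} f g hfg := by
    obtain ⟨p, _, _, _⟩ := h.exists_epi_free hE Y
    rw [← cancel_epi p]
    exact free_hom_ext fun i ↦ by rw [E.map_comp, E.map_comp, hfg]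

lemma full (h : EvaluationAdjunctions E)
    (hE : ∀ Y : K, (∀ i, IsZero ((E.obj Y).obj i)) → IsZero Y) : E.Full where
  map_surjective {Y Y'} g := by
    have := h.faithful hE
    obtain ⟨p, hp, _, _⟩ := h.exists_epi_free hE Y
    obtain ⟨p', hp'⟩ := h.exists_free_desc (fun i ↦ g.app i)
    have h₁ : E.map p' = E.map p ≫ g := map_free_hom_ext fun i ↦ by
      rw [hp', NatTrans.comp_app, reassoc_of% hp]
    have h₂ : kernel.ι p ≫ p' = 0 := E.map_injective (by
      rw [E.map_comp, h₁, ← E.map_comp_assoc, kernel.condition, E.map_zero, E.map_zero, zero_comp])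
    refine ⟨Abelian.epiDesc p p' h₂, ?_⟩
    rw [← cancel_epi (E.map p), ← E.map_comp, Abelian.comp_epiDesc, h₁]

lemma essSurj [Quiver.IsThin I] (h : EvaluationAdjunctions E)
    (hE : ∀ Y : K, (∀ i, IsZero ((E.obj Y).obj i)) → IsZero Y) : E.EssSurj where
  mem_essImage M := by
    have := h.full hE
    have := h.preservesFiniteColimits
    obtain ⟨φ, _⟩ := h.exists_epi_map_free M
    obtain ⟨ψ, _⟩ := h.exists_epi_map_free (kernel φ)
    obtain ⟨θ, hθ⟩ := E.map_surjective (ψ ≫ kernel.ι φ)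
    exact ⟨cokernel θ, ⟨PreservesCokernel.iso E θ ≪≫ cokernelIsoOfEq hθ ≪≫ cokernelEpiComp _ _ ≪≫
      (cokernelIsCokernel (kernel.ι φ)).coconePointUniqueUpToIso
        (Abelian.epiIsCokernelOfKernel (Fork.ofι (kernel.ι φ) _) (kernelIsKernel φ))⟩⟩

lemma isEquivalence [Quiver.IsThin I] (h : EvaluationAdjunctions E)
    (hE : ∀ Y : K, (∀ i, IsZero ((E.obj Y).obj i)) → IsZero Y) : E.IsEquivalence where
  faithful := h.faithful hE
  full := h.full hE
  essSurj := h.essSurj hE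

end EvaluationAdjunctions

end HRS

/-! ### Diagrams in the heart indexed by preordered sets -/

namespace HRS

variable (I : Type u') [Category.{v'} I] [Quiver.IsThin I] (A : Type u) [Category.{v} A] [Abelian A]

instance (i : I) : PreservesFiniteColimits (evaluationLeftAdjoint A i) :=
  have := (evaluationAdjunctionRight A i).leftAdjoint_preservesColimits
  ⟨fun _ ↦ inferInstance⟩

instance (i : I) : PreservesFiniteLimits (evaluationRightAdjoint A i) :=
  have := (evaluationAdjunctionLeft A i).rightAdjoint_preservesLimits
  ⟨fun _ ↦ inferInstance⟩

instance (i : I) : (evaluationLeftAdjoint A i).Additive :=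
  have := preservesBinaryBiproducts_of_preservesBinaryCoproducts (evaluationLeftAdjoint A i)
  Functor.additive_of_preservesBinaryBiproducts _

instance (i : I) : (evaluationRightAdjoint A i).Additive :=
  Functor.additive_of_preserves_binary_products _

instance (i : I) : PreservesFiniteLimits (evaluationLeftAdjoint A i) := by
  have : (evaluationLeftAdjoint A i).PreservesMonomorphisms := ⟨fun {X Y} f _ ↦ by
    have (j : I) : Mono (((evaluationLeftAdjoint A i).map f).app j) := by
      let τ := Discrete.natTrans (F := Discrete.functor fun _ : i ⟶ j ↦ X)
        (G := Discrete.functor fun _ : i ⟶ j ↦ Y) fun _ ↦ f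
      have h : ((evaluationLeftAdjoint A i).map f).app j = colim.map τ :=
        Sigma.hom_ext _ _ fun g ↦
          (colimit.ι_desc _ _).trans (ι_colimMap τ ⟨g⟩).symm
      have (k : Discrete (i ⟶ j)) : Mono (τ.app k) := inferInstanceAs (Mono f)
      have : Mono τ := NatTrans.mono_of_mono_app _
      have := HasFiniteBiproducts.of_hasFiniteProducts (C := A)
      have := HasExactColimitsOfShape.preservesFiniteLimits (J := Discrete (i ⟶ j)) (C := A)
      rw [h]
      exact colim.map_mono τ
    exact NatTrans.mono_of_mono_app _⟩
  have := Functor.preservesHomology_of_preservesMonos_and_cokernels (evaluationLeftAdjoint A i)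
  exact Functor.preservesFiniteLimits_of_preservesHomology _

instance (i : I) : PreservesFiniteColimits (evaluationRightAdjoint A i) := by
  have : (evaluationRightAdjoint A i).PreservesEpimorphisms := ⟨fun {X Y} f _ ↦ by
    have (j : I) : Epi (((evaluationRightAdjoint A i).map f).app j) := by
      let τ := Discrete.natTrans (F := Discrete.functor fun _ : j ⟶ i ↦ X)
        (G := Discrete.functor fun _ : j ⟶ i ↦ Y) fun _ ↦ f
      have h : ((evaluationRightAdjoint A i).map f).app j = lim.map τ :=
        Pi.hom_ext _ _ fun g ↦
          (limit.lift_π _ _).trans (limMap_π τ ⟨g⟩).symm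
      have (k : Discrete (j ⟶ i)) : Epi (τ.app k) := inferInstanceAs (Epi f)
      have : Epi τ := NatTrans.epi_of_epi_app _
      have := HasFiniteBiproducts.of_hasFiniteProducts (C := A)
      have := HasExactLimitsOfShape.preservesFiniteColimits (J := Discrete (j ⟶ i)) (C := A)
      rw [h]
      exact lim.map_epi τ
    exact NatTrans.epi_of_epi_app _⟩
  have := Functor.preservesHomology_of_preservesEpis_and_kernels (evaluationRightAdjoint A i)
  exact Functor.preservesFiniteColimits_of_preservesHomology _

variable {I A}

lemma isIso_evaluationAdjunctionLeft_counit {i j : I} (f : i ⟶ j) (X : A) :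
    IsIso (((evaluationRightAdjoint A j).obj X).map f ≫
      (evaluationAdjunctionLeft A j).counit.app X) := by
  have h : ((evaluationRightAdjoint A j).obj X).map f ≫
      (evaluationAdjunctionLeft A j).counit.app X = Pi.π (fun _ : i ⟶ j ↦ X) f := by
    rw [evaluationAdjunctionLeft_counit_app]
    refine (limit.lift_π (F := Discrete.functor fun _ : j ⟶ j ↦ X) _ ⟨𝟙 j⟩).trans ?_
    change Pi.π (fun _ : i ⟶ j ↦ X) (f ≫ 𝟙 j) = _
    rw [Category.comp_id]
  have : IsIso (Pi.π (fun _ : i ⟶ j ↦ X) f) :=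
    ⟨Pi.lift fun _ ↦ 𝟙 X, Pi.hom_ext _ _ fun g ↦ by
      rw [Subsingleton.elim g f, Category.assoc, Pi.lift_π, Category.comp_id,
        Category.id_comp], Pi.lift_π _ _⟩
  rw [h]
  exact this

open DerivedCategory

variable (I A)

section

variable [HasDerivedCategory.{w} A] [HasDerivedCategory.{w'} (I ⥤ A)]

noncomputable def derivedEvalAdjLeft (i : I) :
    (evaluationLeftAdjoint A i).mapDerivedCategory ⊣ derivedEval I A i :=
  derivedAdjunction (evaluationAdjunctionRight A i) _ _

noncomputable def derivedEvalAdjRight (i : I) :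
    derivedEval I A i ⊣ (evaluationRightAdjoint A i).mapDerivedCategory :=
  derivedAdjunction (evaluationAdjunctionLeft A i) _ _

/-- The transition map from the evaluation at `i` to the evaluation at `j` of the image by the right
adjoint of the latter, followed by the counit. -/
noncomputable def derivedEvalMapCounit {i j : I} (f : i ⟶ j) :
    (evaluationRightAdjoint A j).mapDerivedCategory ⋙ derivedEval I A i ⟶ 𝟭 _ :=
  Functor.whiskerLeft ((evaluationRightAdjoint A j).mapDerivedCategory ⋙ derivedToDiagram I A)
    ((evaluation I _).map f) ≫ (derivedEvalAdjRight I A j).counit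

variable {I A}

/-- The analogue of `derivedEvalMapCounit` for complexes. -/
noncomputable def complexEvalMapCounit {i j : I} (f : i ⟶ j) (K : CochainComplex A ℤ) :
    (HomologicalComplex.complexOfFunctorsToFunctorToComplex.obj
      (((evaluationRightAdjoint A j).mapHomologicalComplex (ComplexShape.up ℤ)).obj K)).obj i ⟶ K :=
  (HomologicalComplex.complexOfFunctorsToFunctorToComplex.obj _).map f ≫
    (complexAdjunction (evaluationAdjunctionLeft A j) (ComplexShape.up ℤ)).counit.app K

instance {i j : I} (f : i ⟶ j) (K : CochainComplex A ℤ) : IsIso (complexEvalMapCounit f K) :=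
  have (n : ℤ) : IsIso ((complexEvalMapCounit f K).f n) :=
    isIso_evaluationAdjunctionLeft_counit f (K.X n)
  HomologicalComplex.Hom.isIso_of_components _

lemma derivedEvalMapCounit_app_Q_obj {i j : I} (f : i ⟶ j) (K : CochainComplex A ℤ) :
    (derivedEvalMapCounit I A f).app (Q.obj K) =
      (derivedEval I A i).map ((CatCommSq.iso
        ((evaluationRightAdjoint A j).mapHomologicalComplex (ComplexShape.up ℤ)) Q Q
        (evaluationRightAdjoint A j).mapDerivedCategory).inv.app K) ≫
      ((derivedToDiagramFactors I A).hom.app _).app i ≫ Q.map (complexEvalMapCounit f K) := by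
  refine (congr_arg (_ ≫ ·) (derivedAdjunction_counit_app
    (evaluationAdjunctionLeft A j) (derivedEval I A j) _ K)).trans ?_
  refine (((derivedToDiagram I A).map _).naturality_assoc f _).trans (congr_arg (_ ≫ ·) ?_)
  refine (((derivedToDiagramFactors I A).hom.app _).naturality_assoc f _).trans ?_
  exact congr_arg (_ ≫ ·) (Q.map_comp _ _).symm

lemma isIso_derivedEvalMapCounit_app {i j : I} (f : i ⟶ j) (Z : DerivedCategory A) :
    IsIso ((derivedEvalMapCounit I A f).app Z) := by
  rw [← NatTrans.isIso_app_iff_of_iso _ (Q.objObjPreimageIso Z), derivedEvalMapCounit_app_Q_obj]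
  infer_instance

lemma isZero_derivedEval_evaluationRightAdjoint {i j : I} (hij : IsEmpty (i ⟶ j))
    (Z : DerivedCategory A) :
    IsZero ((derivedEval I A i).obj
      ((evaluationRightAdjoint A j).mapDerivedCategory.obj Z)) := by
  refine isZero_of_isZero_homology _ fun n ↦ ?_
  refine IsZero.of_iso ?_ (homologyObjIso ((evaluation I A).obj i) (derivedEval I A i) _ n)
  refine IsZero.of_iso ?_ (((evaluation I A).obj i).mapIso
    (homologyObjIso (evaluationRightAdjoint A j) _ Z n))
  rw [IsZero.iff_id_eq_zero]
  exact Pi.hom_ext _ _ fun g ↦ (hij.false g).elim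

end

end HRS

namespace TorsionPair

open DerivedCategory HRS

variable {A : Type u} [Category.{v} A] [Abelian A] (t : TorsionPair A)

lemma torsion_pi {J : Type*} [Finite J] (X : J → A) (h : ∀ j, t.torsion (X j)) :
    t.torsion (∏ᶜ X) :=
  have := HasFiniteBiproducts.of_hasFiniteProducts (C := A)
  t.torsion.prop_of_iso ((biproduct.isoCoproduct X).symm ≪≫ biproduct.isoProduct X)
    (t.torsion.prop_colimit _ fun j : Discrete J ↦ h j.as)

lemma torsionFree_sigma {J : Type*} [Finite J] (X : J → A) (h : ∀ j, t.torsionFree (X j)) :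
    t.torsionFree (∐ X) :=
  have := HasFiniteBiproducts.of_hasFiniteProducts (C := A)
  t.torsionFree.prop_of_iso ((biproduct.isoProduct X).symm ≪≫ biproduct.isoCoproduct X)
    (t.torsionFree.prop_limit _ fun j : Discrete J ↦ h j.as)

variable {I : Type u'} [Category.{v'} I] [Quiver.IsThin I]

variable [HasDerivedCategory.{w} A] [HasDerivedCategory.{w'} (I ⥤ A)]

lemma heartAdjunction_counit_app {B : Type*} [Category* B] [Abelian B] {s : TorsionPair B}
    [HasDerivedCategory B] {t : TorsionPair A}
    {Φ' : DerivedCategory A ⥤ DerivedCategory B} {Ψ' : DerivedCategory B ⥤ DerivedCategory A}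
    (adj : Φ' ⊣ Ψ') (hΦ : ∀ X, t.tStructure.heart X → s.tStructure.heart (Φ'.obj X))
    (hΨ : ∀ X, s.tStructure.heart X → t.tStructure.heart (Ψ'.obj X)) (Z : s.Heart) :
    s.tStructure.heart.ι.map ((heartAdjunction adj hΦ hΨ).counit.app Z) =
      adj.counit.app Z.obj := by
  refine (Adjunction.map_restrictFullyFaithful_counit_app adj _ _ _ _ Z).trans ?_
  refine (Category.id_comp _).trans ?_
  exact (congr_arg (· ≫ adj.counit.app Z.obj) (Φ'.map_id _)).trans (Category.id_comp _)

lemma heart_evaluationLeftAdjoint (i : I) (X : DerivedCategory A) (hX : t.tStructure.heart X) :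
    (t.functorCategory I).tStructure.heart ((evaluationLeftAdjoint A i).mapDerivedCategory.obj X) :=
  heart_obj_of_inducedBy t (t.functorCategory I) (evaluationLeftAdjoint A i) _
    (fun _ h _ ↦ t.torsion.prop_colimit _ fun _ ↦ h) (fun _ h _ ↦ t.torsionFree_sigma _ fun _ ↦ h)
    X hX

lemma heart_evaluationRightAdjoint (i : I) (X : DerivedCategory A) (hX : t.tStructure.heart X) :
    (t.functorCategory I).tStructure.heart
      ((evaluationRightAdjoint A i).mapDerivedCategory.obj X) :=
  heart_obj_of_inducedBy t (t.functorCategory I) (evaluationRightAdjoint A i) _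
    (fun _ h _ ↦ t.torsion_pi _ fun _ ↦ h) (fun _ h _ ↦ t.torsionFree.prop_limit _ fun _ ↦ h)
    X hX

variable (I)

/-- The adjoints of the evaluations on the heart of a pointwise torsion pair. -/
noncomputable def evaluationAdjunctions : EvaluationAdjunctions (t.heartToDiagram I) where
  left i := heartFunctor (evaluationLeftAdjoint A i).mapDerivedCategory
    (t.heart_evaluationLeftAdjoint i)
  right i := heartFunctor (evaluationRightAdjoint A i).mapDerivedCategory
    (t.heart_evaluationRightAdjoint i)
  adjLeft i := heartAdjunction (derivedEvalAdjLeft I A i) (t.heart_evaluationLeftAdjoint i)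
    (fun X hX ↦ (t.functorCategory_heart_iff X).1 hX i)
  adjRight i := heartAdjunction (derivedEvalAdjRight I A i)
    (fun X hX ↦ (t.functorCategory_heart_iff X).1 hX i) (t.heart_evaluationRightAdjoint i)
  isIso {i j} f Z := by
    have := isIso_derivedEvalMapCounit_app f Z.obj
    refine (isIso_iff_of_reflects_iso _ t.tStructure.heart.ι).1 ?_
    exact (congr_arg (fun φ ↦ IsIso φ) ((t.tStructure.heart.ι.map_comp _ _).trans
      (congr_arg (_ ≫ ·) (heartAdjunction_counit_app (derivedEvalAdjRight I A j)
        (fun X hX ↦ (t.functorCategory_heart_iff X).1 hX j) (t.heart_evaluationRightAdjoint j)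
          Z)))).mpr this
  isZero {i j} hij Z := by
    have := isZero_derivedEval_evaluationRightAdjoint hij Z.obj
    rw [IsZero.iff_id_eq_zero]
    ext
    exact this.eq_of_src _ _

end TorsionPair

/-! ### Filtered colimits in the heart -/

lemma IsClosedUnderDirectLimits.of_isFiltered {C : Type u} [Category.{v} C]
    {P : ObjectProperty C} (hP : IsClosedUnderDirectLimits.{w} P)
    (J : Type w) [SmallCategory J] [IsFiltered J] : P.IsClosedUnderColimitsOfShape J where
  colimitsOfShape_le := by
    rintro X ⟨F, hF⟩
    obtain ⟨α, _, _, _, Φ, _⟩ := IsFiltered.exists_directed J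
    have : IsDirectedOrder α := ‹_›
    have := hP α
    exact P.prop_of_isColimit ((Functor.Final.isColimitWhiskerEquiv Φ _).symm F.isColimit)
      fun _ ↦ hF _

namespace HRS

lemma isClosedUnderColimitsOfShape_discrete {C : Type u}
    [Category.{v} C] (P : ObjectProperty C) [P.IsClosedUnderIsomorphisms] (S : Type u')
    [HasFiniteCoproducts C] [HasColimitsOfShape (Finset (Discrete S)) C]
    [P.IsClosedUnderColimitsOfShape (Finset (Discrete S))]
    (hP : ∀ (J : Type u') [Finite J] (X : J → C), (∀ j, P (X j)) → P (∐ X)) :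
    P.IsClosedUnderColimitsOfShape (Discrete S) where
  colimitsOfShape_le := by
    rintro X ⟨F, hF⟩
    let c := CoproductsFromFiniteFiltered.liftToFinsetColimitCocone F.diag
    exact P.prop_of_iso (c.isColimit.coconePointUniqueUpToIso F.isColimit)
      (P.prop_colimit (CoproductsFromFiniteFiltered.liftToFinsetObj F.diag)
        fun s ↦ hP s (fun j ↦ F.diag.obj j.1) fun j ↦ hF j.1)

lemma isAB5_of_directed {C : Type u} [Category.{v} C] [Abelian C]
    (h : ∀ (I : Type w) [PartialOrder I] [IsDirectedOrder I] [Nonempty I],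
      ∃ _ : HasColimitsOfShape I C, HasExactColimitsOfShape I C) : IsAB5.{w} C := by
  have key (J : Type w) [SmallCategory J] [IsFiltered J] :
      ∃ _ : HasColimitsOfShape J C, HasExactColimitsOfShape J C := by
    obtain ⟨α, _, _, _, Φ, _⟩ := IsFiltered.exists_directed J
    have : IsDirectedOrder α := ‹_›
    obtain ⟨_, _⟩ := h α
    have : HasColimitsOfShape J C := Functor.Final.hasColimitsOfShape_of_final Φ
    exact ⟨this, hasExactColimitsOfShape_of_final _ Φ⟩
  have : HasFilteredColimitsOfSize.{w, w} C := ⟨fun J _ _ ↦ (key J).1⟩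
  exact ⟨this, ⟨fun J _ _ ↦ (key J).2⟩⟩

end HRS

namespace TorsionPair

open DerivedCategory HRS

variable {A : Type u} [Category.{v} A] [Abelian A] (t : TorsionPair A)

instance (I : Type*) [Category* I] (J : Type*) [Category* J] [HasColimitsOfShape J A]
    [t.torsionFree.IsClosedUnderColimitsOfShape J] :
    (t.functorCategory I).torsionFree.IsClosedUnderColimitsOfShape J where
  colimitsOfShape_le := by
    rintro X ⟨F, hF⟩ i
    exact t.torsionFree.prop_of_isColimit
      (isColimitOfPreserves ((evaluation I A).obj i) F.isColimit)
      fun j ↦ hF j i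

lemma torsionFree_isClosedUnderColimitsOfShape_discrete [HasFilteredColimitsOfSize.{w, w} A]
    (ht : IsClosedUnderDirectLimits.{w} t.torsionFree) (S : Type w) :
    t.torsionFree.IsClosedUnderColimitsOfShape (Discrete S) := by
  classical
  have := ht.of_isFiltered (Finset (Discrete S))
  exact isClosedUnderColimitsOfShape_discrete t.torsionFree S fun _ _ X hX ↦
    t.torsionFree_sigma X hX

variable [HasDerivedCategory.{w} A]

lemma hasColimitsOfShape_discrete_heart (S : Type u') [HasColimitsOfShape (Discrete S) A]
    [HasExactColimitsOfShape (Discrete S) A]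
    [t.torsionFree.IsClosedUnderColimitsOfShape (Discrete S)] :
    HasColimitsOfShape (Discrete S) t.Heart := by
  let := HasDerivedCategory.standard (Discrete S ⥤ A)
  have : (t.heartToDiagram (Discrete S)).IsEquivalence := { }
  exact t.hasColimitsOfShape_heart (Discrete S)

lemma isEquivalence_heartToDiagram (I : Type u') [Category.{v'} I] [Quiver.IsThin I]
    [HasDerivedCategory.{w'} (I ⥤ A)] [HasColimitsOfShape (Discrete I) A]
    [HasExactColimitsOfShape (Discrete I) A]
    [t.torsionFree.IsClosedUnderColimitsOfShape (Discrete I)] :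
    (t.heartToDiagram I).IsEquivalence := by
  have := (t.functorCategory I).hasColimitsOfShape_discrete_heart I
  exact (t.evaluationAdjunctions I).isEquivalence
    (fun Y hY ↦ t.isZero_of_isZero_heartToDiagram I Y hY)

lemma isAB5_heart [IsGrothendieckAbelian.{v'} A]
    (ht : IsClosedUnderDirectLimits.{v'} t.torsionFree) : IsAB5.{v'} t.Heart :=
  isAB5_of_directed fun I _ _ _ ↦ by
    have := ht I
    have := t.torsionFree_isClosedUnderColimitsOfShape_discrete ht I
    let := HasDerivedCategory.standard (I ⥤ A)
    have := t.isEquivalence_heartToDiagram I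
    have := t.hasColimitsOfShape_heart I
    exact ⟨this, t.hasExactColimitsOfShape_heart I⟩

end TorsionPair

/-! ### Torsion and torsion-free objects in the heart -/

namespace HRS

open DerivedCategory

variable {A : Type u} [Category.{v} A] [Abelian A] [HasDerivedCategory.{w} A]

lemma exists_distTriang_singleFunctor_map (n : ℤ) (S : ShortComplex A) (hS : S.ShortExact) :
    ∃ δ, Triangle.mk ((singleFunctor A n).map S.f) ((singleFunctor A n).map S.g) δ ∈
      distTriang (DerivedCategory A) :=
  ⟨_, triangleOfSES_distinguished
    (hS.map_of_exact (HomologicalComplex.single A (ComplexShape.up ℤ) n))⟩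

lemma exists_distTriang_singleFunctor_obj (M : DerivedCategory A) (n m : ℤ) (hm : n + 1 = m)
    [M.IsGE n] [M.IsLE m] :
    ∃ (X Y : A) (a : (singleFunctor A n).obj X ⟶ M) (b : M ⟶ (singleFunctor A m).obj Y)
      (c : (singleFunctor A m).obj Y ⟶ ((singleFunctor A n).obj X)⟦(1 : ℤ)⟧),
      Triangle.mk a b c ∈ distTriang (DerivedCategory A) := by
  obtain ⟨B, C, hB, hC, a, b, c, hT⟩ := TStructure.t.exists_triangle M n m hm
  replace hB : B.IsLE n := ⟨hB⟩
  replace hC : C.IsGE m := ⟨hC⟩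
  have leB₁ : IsLE (B⟦(1 : ℤ)⟧) (n - 1) := TStructure.t.isLE_shift B n 1 (n - 1)
  have leB₁' : IsLE (B⟦(1 : ℤ)⟧) m := TStructure.t.isLE_of_le _ (n - 1) m
  have leC : C.IsLE m := TStructure.t.isLE₂ _ (rot_of_distTriang _ hT) m ‹_› leB₁'
  have geC₁ : IsGE (C⟦(-1 : ℤ)⟧) (m + 1) := TStructure.t.isGE_shift C m (-1) (m + 1)
  have geC₁' : IsGE (C⟦(-1 : ℤ)⟧) n := TStructure.t.isGE_of_ge _ n (m + 1)
  have geB : B.IsGE n := TStructure.t.isGE₂ _ (inv_rot_of_distTriang _ hT) n geC₁' ‹_›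
  obtain ⟨X, ⟨eX⟩⟩ := exists_iso_singleFunctor_obj_of_isGE_of_isLE B n
  obtain ⟨Y, ⟨eY⟩⟩ := exists_iso_singleFunctor_obj_of_isGE_of_isLE C m
  exact ⟨X, Y, _, _, _, distTriang_of_iso₁ (distTriang_of_iso₃ hT eY rfl) eX⟩

end HRS

namespace TorsionPair

open DerivedCategory HRS

variable {A : Type u} [Category.{v} A] [Abelian A] (t : TorsionPair A) [HasDerivedCategory.{w} A]

lemma heart_singleFunctor_zero (X : A) (hX : t.torsion X) :
    t.tStructure.heart ((singleFunctor A 0).obj X) := by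
  rw [mem_heart_iff]
  have : ((singleFunctor A 0).obj X).IsGE (-1) :=
    DerivedCategory.TStructure.t.isGE_of_ge _ (-1) 0
  exact ⟨⟨inferInstance,
    t.torsion.prop_of_iso ((singleFunctorCompHomologyFunctorIso A 0).app X).symm hX⟩, this,
    t.torsionFree_of_isZero (isZero_of_isGE _ 0 (-1) (by simp))⟩

lemma heart_singleFunctor_neg_one (X : A) (hX : t.torsionFree X) :
    t.tStructure.heart ((singleFunctor A (-1)).obj X) := by
  rw [mem_heart_iff]
  have : ((singleFunctor A (-1)).obj X).IsLE 0 :=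
    DerivedCategory.TStructure.t.isLE_of_le _ (-1) 0
  exact ⟨⟨this, t.torsion_of_isZero (isZero_of_isLE _ (-1) 0 (by simp))⟩, inferInstance,
    t.torsionFree.prop_of_iso ((singleFunctorCompHomologyFunctorIso A (-1)).app X).symm hX⟩

/-- The functor which sends a torsion object to the corresponding complex in degree `0`. -/
noncomputable def torsionToHeart : t.torsion.FullSubcategory ⥤ t.Heart :=
  t.tStructure.heart.lift (t.torsion.ι ⋙ singleFunctor A 0)
    fun X ↦ t.heart_singleFunctor_zero X.obj X.property

/-- The functor which sends a torsion-free object to the corresponding complex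
in degree `-1`. -/
noncomputable def freeToHeart : t.torsionFree.FullSubcategory ⥤ t.Heart :=
  t.tStructure.heart.lift (t.torsionFree.ι ⋙ singleFunctor A (-1))
    fun X ↦ t.heart_singleFunctor_neg_one X.obj X.property

instance : t.torsionToHeart.Full := by unfold torsionToHeart; infer_instance
instance : t.torsionToHeart.Faithful := by unfold torsionToHeart; infer_instance

instance : t.freeToHeart.Full := by unfold freeToHeart; infer_instance
instance : t.freeToHeart.Faithful := by unfold freeToHeart; infer_instance
instance : t.freeToHeart.Additive where
  map_add {X Y f g} := by
    ext
    exact (singleFunctor A (-1)).map_add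

lemma freeToHeart_hom_eq_zero {X : t.torsionFree.FullSubcategory}
    {Y : t.torsion.FullSubcategory} (f : t.freeToHeart.obj X ⟶ t.torsionToHeart.obj Y) :
    f = 0 := by
  ext
  exact DerivedCategory.TStructure.t.zero_of_isLE_of_isGE f.hom (-1) 0 (by simp)
    (inferInstanceAs (((singleFunctor A (-1)).obj X.obj).IsLE (-1)))
    (inferInstanceAs (((singleFunctor A 0).obj Y.obj).IsGE 0))

lemma shortExact_freeToHeart {X₁ X₂ X₃ : t.torsionFree.FullSubcategory} (f : X₁ ⟶ X₂)
    (g : X₂ ⟶ X₃) (w : f.hom ≫ g.hom = 0) (h : (ShortComplex.mk f.hom g.hom w).ShortExact)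
    (w' : t.freeToHeart.map f ≫ t.freeToHeart.map g = 0) :
    (ShortComplex.mk (t.freeToHeart.map f) (t.freeToHeart.map g) w').ShortExact := by
  obtain ⟨δ, hδ⟩ := exists_distTriang_singleFunctor_map (-1) _ h
  exact shortExact_of_distTriang_heart t.tStructure _ δ hδ

lemma exists_shortExact_heart (M : t.Heart) :
    ∃ (X : t.torsionFree.FullSubcategory) (Y : t.torsion.FullSubcategory)
      (i : t.freeToHeart.obj X ⟶ M) (p : M ⟶ t.torsionToHeart.obj Y) (w : i ≫ p = 0),
      (ShortComplex.mk i p w).ShortExact := by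
  obtain ⟨⟨hM₀, hM₀'⟩, hM₁, hM₁'⟩ := (t.mem_heart_iff _).1 M.property
  obtain ⟨X, Y, a, b, c, hT⟩ := exists_distTriang_singleFunctor_obj M.obj (-1) 0 (by simp)
  have : IsIso ((homologyFunctor A (-1)).map a) :=
    isIso_homologyMap_mor₁ _ hT (-2) (-1) rfl
      (isZero_of_isGE ((singleFunctor A 0).obj Y) 0 (-2) (by simp))
      (isZero_of_isGE ((singleFunctor A 0).obj Y) 0 (-1) (by simp))
  have : IsIso ((homologyFunctor A 0).map b) :=
    isIso_homologyMap_mor₂ _ hT 0 1 rfl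
      (isZero_of_isLE ((singleFunctor A (-1)).obj X) (-1) 0 (by simp))
      (isZero_of_isLE ((singleFunctor A (-1)).obj X) (-1) 1 (by simp))
  have hX : t.torsionFree X := t.torsionFree.prop_of_iso
    ((asIso ((homologyFunctor A (-1)).map a)).symm ≪≫
      (singleFunctorCompHomologyFunctorIso A (-1)).app X) hM₁'
  have hY : t.torsion Y := t.torsion.prop_of_iso
    (asIso ((homologyFunctor A 0).map b) ≪≫
      (singleFunctorCompHomologyFunctorIso A 0).app Y) hM₀'
  let i : t.freeToHeart.obj ⟨X, hX⟩ ⟶ M := ObjectProperty.homMk a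
  let p : M ⟶ t.torsionToHeart.obj ⟨Y, hY⟩ := ObjectProperty.homMk b
  have w : i ≫ p = 0 := t.freeToHeart_hom_eq_zero _
  exact ⟨⟨X, hX⟩, ⟨Y, hY⟩, i, p, w, shortExact_of_distTriang_heart t.tStructure _ c hT⟩

lemma freeToHeart_cocone_eq_zero {J : Type*} [Category* J]
    {F : J ⥤ t.torsionFree.FullSubcategory} {c : Cocone (F ⋙ t.torsionFree.ι)}
    (hc : IsColimit c) (hT : t.torsion c.pt) (s : Cocone (F ⋙ t.freeToHeart)) (j : J) :
    s.ι.app j = 0 := by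
  obtain ⟨X, Y, i, p, w, h⟩ := t.exists_shortExact_heart s.pt
  have := h.mono_f
  choose φ hφ using fun j ↦
    t.freeToHeart.map_surjective (h.exact.lift (s.ι.app j) (t.freeToHeart_hom_eq_zero _))
  have hφi (j) : t.freeToHeart.map (φ j) ≫ i = s.ι.app j := by
    rw [hφ]
    exact h.exact.lift_f _ _
  have hφw {j j'} (f : j ⟶ j') : F.map f ≫ φ j' = φ j := t.freeToHeart.map_injective (by
    rw [← cancel_mono i, Functor.map_comp, Category.assoc, hφi, hφi]
    exact s.w f)
  let s' : Cocone F :=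
    { pt := X
      ι := { app := φ, naturality _ _ f := (hφw f).trans (Category.comp_id _).symm } }
  have hφ₀ : φ j = 0 := by
    ext
    refine (hc.fac (t.torsionFree.ι.mapCocone s') j).symm.trans ?_
    rw [t.hom_eq_zero (hc.desc (t.torsionFree.ι.mapCocone s')) hT X.property, comp_zero]
    rfl
  rw [← hφi, hφ₀, Functor.map_zero, zero_comp]

end TorsionPair

/-! ### Filtered colimits in the torsion-free class -/

section

attribute [local instance] IsFiltered.isConnected

namespace HRS

lemma mono_sigmaDesc_of_finite {C : Type u} [Category.{v} C] [Abelian C] {J K : Type*} [Finite J]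
    [DecidableEq K] (X : K → C) [HasProduct X] (e : J → K) (he : Function.Injective e)
    (φ : (∐ fun j ↦ X (e j)) ⟶ ∏ᶜ X)
    (hφ : ∀ j, Sigma.ι (fun j ↦ X (e j)) j ≫ φ = Pi.ι X (e j)) : Mono φ := by
  classical
  have := Fintype.ofFinite J
  let r : ∏ᶜ X ⟶ ∐ fun j ↦ X (e j) := ∑ j, Pi.π X (e j) ≫ Sigma.ι (fun j ↦ X (e j)) j
  have hr : φ ≫ r = 𝟙 _ := Limits.Sigma.hom_ext _ _ fun j ↦ by
    rw [← Category.assoc, hφ, Preadditive.comp_sum, Category.comp_id, Finset.sum_eq_single j]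
    · rw [Pi.ι_π_eq_id_assoc]
    · intro k _ hk
      rw [Pi.ι_π_of_ne_assoc _ (fun h ↦ hk (he h).symm), zero_comp]
    · simp
  exact mono_of_mono_fac hr

lemma mono_sigmaDesc_piι {C : Type u} [Category.{v} C] [Abelian C] {S : Type u'} [DecidableEq S]
    (X : S → C) [HasCoproduct X] [HasProduct X] [HasColimitsOfShape (Finset (Discrete S)) C]
    [HasExactColimitsOfShape (Finset (Discrete S)) C] :
    Mono (Limits.Sigma.desc fun s ↦ Pi.ι X s) := by
  classical
  have := HasExactColimitsOfShape.preservesFiniteLimits (J := Finset (Discrete S)) (C := C)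
  let F := CoproductsFromFiniteFiltered.liftToFinsetObj (Discrete.functor X)
  let c := CoproductsFromFiniteFiltered.finiteSubcoproductsCocone X
  let σ : ∐ X ⟶ ∏ᶜ X := Limits.Sigma.desc fun s ↦ Pi.ι X s
  let φ : F ⟶ (Functor.const _).obj (∏ᶜ X) := c.ι ≫ (Functor.const _).map σ
  have (s : Finset (Discrete S)) : Mono (φ.app s) :=
    mono_sigmaDesc_of_finite X (fun j : s ↦ j.1.as)
      (fun j j' h ↦ Subtype.ext (Discrete.ext h)) _ fun j ↦ by
        have h : Sigma.ι (fun j : s ↦ X j.1.as) j ≫ c.ι.app s = Sigma.ι X j.1.as :=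
          Limits.Sigma.ι_desc _ _
        exact (Category.assoc _ _ _).symm.trans ((congr_arg (· ≫ σ) h).trans
          (Limits.Sigma.ι_desc _ _))
  have := NatTrans.mono_of_mono_app φ
  exact colim.map_mono' φ (CoproductsFromFiniteFiltered.isColimitFiniteSubproductsCocone X)
    (isColimitConstCocone _ _) σ fun s ↦ (Category.comp_id _).symm

lemma epi_sigmaDesc_of_isColimit {C : Type*} [Category* C] {J : Type*} [Category* J]
    {F : J ⥤ C} {c : Cocone F} (hc : IsColimit c) [HasCoproduct F.obj] :
    Epi (Limits.Sigma.desc c.ι.app) where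
  left_cancellation a b hab := hc.hom_ext fun j ↦ by
    simpa only [colimit.ι_desc_assoc, Cofan.mk_ι_app] using congr_arg (Sigma.ι F.obj j ≫ ·) hab

variable {C : Type u} [Category.{v} C] [Abelian C]

lemma exists_shortExact_pullback {X₁ X₂ X₃ Y : C} {f : X₁ ⟶ X₂} {g : X₂ ⟶ X₃} {w : f ≫ g = 0}
    (h : (ShortComplex.mk f g w).ShortExact) (y : Y ⟶ X₃) :
    ∃ (f' : X₁ ⟶ pullback g y) (w' : f' ≫ pullback.snd g y = 0),
      (ShortComplex.mk f' (pullback.snd g y) w').ShortExact := by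
  have : Mono f := h.mono_f
  have : Epi g := h.epi_g
  let f' : X₁ ⟶ pullback g y := pullback.lift f 0 (by rw [w, zero_comp])
  have hf' : f' ≫ pullback.fst g y = f := pullback.lift_fst _ _ _
  have w' : f' ≫ pullback.snd g y = 0 := pullback.lift_snd _ _ _
  have : Mono f' := mono_of_mono_fac hf'
  have exact : (ShortComplex.mk f' (pullback.snd g y) w').Exact :=
    ShortComplex.exact_of_f_is_kernel _ (KernelFork.IsLimit.ofι' _ _ fun k hk ↦
      ⟨h.exact.lift (k ≫ pullback.fst g y) (by
          rw [Category.assoc, pullback.condition, reassoc_of% hk, zero_comp]),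
        pullback.hom_ext (by rw [Category.assoc, hf']; exact h.exact.lift_f _ _)
          (by rw [Category.assoc, w', comp_zero]; exact hk.symm)⟩)
  exact ⟨f', w', .mk' exact ‹_› inferInstance⟩

variable {I : Type u'} [Category.{v'} I]

lemma exists_retraction_of_isZero_colimit [IsFiltered I] [HasColimitsOfShape I C]
    [HasExactColimitsOfShape I C] {K : C} {P F : I ⥤ C} (f : (Functor.const I).obj K ⟶ P)
    (g : P ⟶ F) (w : f ≫ g = 0) (h : (ShortComplex.mk f g w).ShortExact)
    (hF : IsZero (colimit F)) : ∃ r : P ⟶ (Functor.const I).obj K, f ≫ r = 𝟙 _ := by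
  have := HasExactColimitsOfShape.preservesFiniteLimits (J := I) (C := C)
  have : IsIso (colim.map f) := (h.map_of_exact colim).isIso_f_iff.2 hF
  let e : colimit ((Functor.const I).obj K) ≅ K :=
    (colimit.isColimit _).coconePointUniqueUpToIso (isColimitConstCocone I K)
  have he (i) : colimit.ι ((Functor.const I).obj K) i ≫ e.hom = 𝟙 K :=
    (colimit.isColimit _).comp_coconePointUniqueUpToIso_hom (isColimitConstCocone I K) i
  refine ⟨(colimit.cocone P).ι ≫ (Functor.const I).map (inv (colim.map f) ≫ e.hom), ?_⟩
  ext i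
  have hi : f.app i ≫ colimit.ι P i = colimit.ι ((Functor.const I).obj K) i ≫ colim.map f :=
    (ι_colimMap f i).symm
  change f.app i ≫ colimit.ι P i ≫ inv (colim.map f) ≫ e.hom = 𝟙 K
  rw [reassoc_of% hi, IsIso.hom_inv_id_assoc, he]

end HRS

namespace TorsionPair

open HRS

variable {A : Type u} [Category.{v} A] [Abelian A] (t : TorsionPair A)

lemma torsionFree_isClosedUnderColimitsOfShape_discrete_of_isGrothendieckAbelian
    [IsGrothendieckAbelian.{v'} A] (S : Type v') :
    t.torsionFree.IsClosedUnderColimitsOfShape (Discrete S) := by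
  classical
  refine ⟨?_⟩
  rintro X ⟨F, hF⟩
  let Y (s : S) : A := F.diag.obj ⟨s⟩
  have := mono_sigmaDesc_piι Y
  have hY : t.torsionFree (∐ Y) :=
    t.torsionFree_of_mono (Limits.Sigma.desc fun s ↦ Pi.ι Y s)
      (t.torsionFree.prop_limit _ fun s : Discrete S ↦ hF s)
  exact t.torsionFree.prop_of_iso (((colimit.isColimit _).coconePointsIsoOfNatIso F.isColimit
    Discrete.natIsoFunctor.symm)) hY

variable [HasDerivedCategory.{w} A] {I : Type u'} [Category.{v'} I] [HasColimitsOfShape I t.Heart]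

lemma isZero_colimit_freeToHeart {F : I ⥤ t.torsionFree.FullSubcategory}
    {c : Cocone (F ⋙ t.torsionFree.ι)} (hc : IsColimit c) (hT : t.torsion c.pt) :
    IsZero (colimit (F ⋙ t.freeToHeart)) := by
  rw [IsZero.iff_id_eq_zero]
  refine colimit.hom_ext fun i ↦ ?_
  rw [comp_zero, Category.comp_id]
  exact t.freeToHeart_cocone_eq_zero hc hT (colimit.cocone _) i

variable [IsFiltered I] [HasExactColimitsOfShape I t.Heart]

lemma exists_retraction_fullSubcategory_of_torsion {K : t.torsionFree.FullSubcategory}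
    {P F : I ⥤ t.torsionFree.FullSubcategory} (f : (Functor.const I).obj K ⟶ P) (g : P ⟶ F)
    (w : f ≫ g = 0)
    (h : ∀ i, (ShortComplex.mk (f.app i).hom (g.app i).hom
      (congr_arg (·.hom) (NatTrans.congr_app w i))).ShortExact)
    {c : Cocone (F ⋙ t.torsionFree.ι)} (hc : IsColimit c) (hT : t.torsion c.pt) :
    ∃ r : P ⟶ (Functor.const I).obj K, f ≫ r = 𝟙 _ := by
  let Φ := (Functor.whiskeringRight I _ _).obj t.freeToHeart
  let e := Functor.constComp I K t.freeToHeart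
  have w₁ : Φ.map f ≫ Φ.map g = 0 := by
    rw [← Φ.map_comp, w]
    exact Functor.whiskerRight_zero _
  have h₁ : (ShortComplex.mk (Φ.map f) (Φ.map g) w₁).ShortExact :=
    shortExact_of_evaluation _ fun i ↦ t.shortExact_freeToHeart (f.app i) (g.app i) _ (h i) _
  have w₂ : (e.inv ≫ Φ.map f) ≫ Φ.map g = 0 := by rw [Category.assoc, w₁, comp_zero]
  let E : ShortComplex.mk (Φ.map f) (Φ.map g) w₁ ≅ ShortComplex.mk (e.inv ≫ Φ.map f) _ w₂ :=
    ShortComplex.isoMk e (Iso.refl _) (Iso.refl _)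
      ((e.hom_inv_id_assoc _).trans (Category.comp_id _).symm)
      ((Category.id_comp _).trans (Category.comp_id _).symm)
  obtain ⟨r, hr⟩ := exists_retraction_of_isZero_colimit _ _ w₂ (ShortComplex.shortExact_of_iso E h₁)
    (t.isZero_colimit_freeToHeart hc hT)
  refine ⟨Φ.preimage (r ≫ e.inv), Φ.map_injective ?_⟩
  rw [Φ.map_comp, Φ.map_preimage, ← cancel_epi e.inv, ← Category.assoc, ← Category.assoc, hr,
    Category.id_comp]
  exact ((congr_arg (e.inv ≫ ·) (Φ.map_id _)).trans (Category.comp_id _)).symm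

lemma exists_retraction_of_torsion {K : A} {P F : I ⥤ A} {f : (Functor.const I).obj K ⟶ P}
    {g : P ⟶ F} {w : f ≫ g = 0} (h : (ShortComplex.mk f g w).ShortExact)
    (hK : t.torsionFree K) (hP : ∀ i, t.torsionFree (P.obj i)) (hF : ∀ i, t.torsionFree (F.obj i))
    {c : Cocone F} (hc : IsColimit c) (hT : t.torsion c.pt) :
    ∃ r : P ⟶ (Functor.const I).obj K, f ≫ r = 𝟙 _ := by
  let P' := t.torsionFree.lift P hP
  let F' := t.torsionFree.lift F hF
  let f' : (Functor.const I).obj ⟨K, hK⟩ ⟶ P' :=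
    { app i := ObjectProperty.homMk (f.app i)
      naturality i j φ := by ext; exact f.naturality φ }
  let g' : P' ⟶ F' :=
    { app i := ObjectProperty.homMk (g.app i)
      naturality i j φ := by ext; exact g.naturality φ }
  have w' : f' ≫ g' = 0 := by
    ext i
    exact NatTrans.congr_app w i
  obtain ⟨r, hr⟩ := t.exists_retraction_fullSubcategory_of_torsion f' g' w'
    (fun i ↦ h.map_of_exact ((evaluation I A).obj i)) hc hT
  exact ⟨{ app i := (r.app i).hom, naturality i j φ := congr_arg (·.hom) (r.naturality φ) },
    by ext i; exact congr_arg (·.hom) (NatTrans.congr_app hr i)⟩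

variable [HasColimitsOfShape (Discrete I) A]
  [t.torsionFree.IsClosedUnderColimitsOfShape (Discrete I)]

lemma isZero_of_isColimit_of_torsion {F : I ⥤ A} {c : Cocone F} (hc : IsColimit c)
    (hF : ∀ i, t.torsionFree (F.obj i)) (hT : t.torsion c.pt) : IsZero c.pt := by
  let p : ∐ F.obj ⟶ c.pt := Limits.Sigma.desc c.ι.app
  have hP : t.torsionFree (∐ F.obj) := t.torsionFree.prop_colimit _ fun i ↦ hF i.as
  have : Epi p := epi_sigmaDesc_of_isColimit hc
  have hp : (ShortComplex.mk _ _ (kernel.condition p)).ShortExact :=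
    .mk' (ShortComplex.exact_kernel p) inferInstance ‹_›
  obtain ⟨f, w, h⟩ := exists_shortExact_pullback (g := (Functor.const I).map p)
    (hp.map_of_exact (Functor.const I)) c.ι
  have hQ (i) : t.torsionFree ((pullback ((Functor.const I).map p) c.ι).obj i) := by
    rw [torsionFree_iff]
    intro X k hX
    exact ((IsPullback.of_hasPullback _ _).map ((evaluation I A).obj i)).hom_ext
      ((t.hom_eq_zero _ hX hP).trans zero_comp.symm)
      ((t.hom_eq_zero _ hX (hF i)).trans zero_comp.symm)
  obtain ⟨r, hr⟩ := t.exists_retraction_of_torsion h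
    (t.torsionFree_of_mono (kernel.ι p) hP) hQ hF hc hT
  let s := ShortComplex.Splitting.ofExactOfRetraction _ h.exact r hr h.epi_g
  have hs : (s.s ≫ pullback.fst _ _) ≫ (Functor.const I).map p = c.ι := by
    rw [Category.assoc, pullback.condition]
    exact s.s_g_assoc _
  let q : c.pt ⟶ ∐ F.obj := hc.desc ⟨_, s.s ≫ pullback.fst _ _⟩
  have hqp : q ≫ p = 𝟙 c.pt := hc.hom_ext fun i ↦ by
    rw [hc.fac_assoc]
    exact (NatTrans.congr_app hs i).trans (Category.comp_id _).symm
  rw [IsZero.iff_id_eq_zero, ← hqp, t.hom_eq_zero q hT hP, zero_comp]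

variable [HasColimitsOfShape I A] [HasExactColimitsOfShape I A]

lemma torsionFree_of_isColimit {F : I ⥤ A} {c : Cocone F} (hc : IsColimit c)
    (hF : ∀ i, t.torsionFree (F.obj i)) : t.torsionFree c.pt := by
  have := HasExactColimitsOfShape.preservesFiniteLimits (J := I) (C := A)
  let τ : F ⟶ (Functor.const I).obj (t.freePart c.pt) :=
    c.ι ≫ (Functor.const I).map (t.freePartπ c.pt)
  let c' := colimit.cocone (kernel τ)
  let hc' : IsColimit c' := colimit.isColimit (kernel τ)
  let m : c'.pt ⟶ c.pt := hc'.desc ⟨c.pt, kernel.ι τ ≫ c.ι⟩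
  have hm (i) : c'.ι.app i ≫ m = (kernel.ι τ).app i ≫ c.ι.app i := hc'.fac _ i
  have : Mono m := colim.map_mono' (kernel.ι τ) hc' hc m hm
  have hS := colim.exact_mapShortComplex (ShortComplex.exact_kernel τ) hc' hc
    (isColimitConstCocone I (t.freePart c.pt)) m (t.freePartπ c.pt) hm
    (fun i ↦ (Category.comp_id _).symm)
  let e : c'.pt ≅ t.torsionPart c.pt := IsLimit.conePointUniqueUpToIso
    (@ShortComplex.Exact.fIsKernel _ _ _ _ _ hS ‹Mono m›)
    (t.shortExact_torsionPart c.pt).exact.fIsKernel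
  have hz : IsZero c'.pt := t.isZero_of_isColimit_of_torsion hc'
    (fun i ↦ t.torsionFree_of_mono ((kernel.ι τ).app i) (hF i))
    (t.torsion.prop_of_iso e.symm (t.torsion_torsionPart _))
  have : Mono (t.freePartπ c.pt) := hS.mono_g (hz.eq_of_src _ _)
  exact t.torsionFree_of_mono (t.freePartπ c.pt) (t.torsionFree_freePart _)

lemma isClosedUnderDirectLimits_of_isAB5_heart [IsGrothendieckAbelian.{v'} A]
    (h : IsAB5.{v'} t.Heart) : IsClosedUnderDirectLimits.{v'} t.torsionFree := by
  obtain ⟨_, _⟩ := h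
  intro I _ _ _
  have := t.torsionFree_isClosedUnderColimitsOfShape_discrete_of_isGrothendieckAbelian I
  constructor
  rintro X ⟨⟨F, ι, hι⟩, hF⟩
  exact t.torsionFree_of_isColimit hι hF

end TorsionPair

end

/-! ### The heart is locally small -/

namespace HRS

lemma small_of_small_ker {M N : Type*} [AddCommGroup M] [AddCommGroup N] (f : M →+ N)
    [Small.{w} N] [Small.{w} f.ker] : Small.{w} M := by
  choose σ hσ using fun y : f.range ↦ y.2
  let g (x : M) : N × f.ker := ⟨f x, x - σ ⟨f x, x, rfl⟩, by simp [f.mem_ker, hσ]⟩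
  have hg : Function.Injective g := fun x y h ↦ by
    have h₁ : f x = f y := congr_arg Prod.fst h
    have h₂ : x - σ ⟨f x, x, rfl⟩ = y - σ ⟨f y, y, rfl⟩ := congr_arg (fun z ↦ (z.2 : M)) h
    have h₃ : σ ⟨f x, x, rfl⟩ = σ ⟨f y, y, rfl⟩ := by congr 1; exact Subtype.ext h₁
    rw [h₃] at h₂
    exact sub_left_injective h₂
  exact small_of_injective hg

variable {C : Type u} [Category.{v} C] [Abelian C] {S : ShortComplex C}

lemma small_hom_to_of_exact (hS : S.Exact) [Mono S.f] (X : C) [Small.{w} (X ⟶ S.X₁)]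
    [Small.{w} (X ⟶ S.X₃)] : Small.{w} (X ⟶ S.X₂) := by
  let f : (X ⟶ S.X₂) →+ (X ⟶ S.X₃) := Preadditive.rightComp X S.g
  have : Small.{w} f.ker := by
    refine small_of_injective (f := fun x : f.ker ↦ hS.lift x.1 x.2) fun x y h ↦ Subtype.ext ?_
    rw [← hS.lift_f x.1 x.2, ← hS.lift_f y.1 y.2]
    exact congr_arg (· ≫ S.f) h
  exact small_of_small_ker f

lemma small_hom_from_of_exact (hS : S.Exact) [Epi S.g] (X : C) [Small.{w} (S.X₁ ⟶ X)]
    [Small.{w} (S.X₃ ⟶ X)] : Small.{w} (S.X₂ ⟶ X) := by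
  let f : (S.X₂ ⟶ X) →+ (S.X₁ ⟶ X) := Preadditive.leftComp X S.f
  have : Small.{w} f.ker := by
    refine small_of_injective (f := fun x : f.ker ↦ hS.desc x.1 x.2) fun x y h ↦ Subtype.ext ?_
    rw [← hS.g_desc x.1 x.2, ← hS.g_desc y.1 y.2]
    exact congr_arg (S.g ≫ ·) h
  exact small_of_small_ker f

end HRS

namespace TorsionPair

open DerivedCategory HRS

variable {A : Type u} [Category.{v} A] [Abelian A] (t : TorsionPair A) [HasDerivedCategory.{w} A]

lemma locallySmall_heart [HasExt.{w'} A] : LocallySmall.{w'} t.Heart where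
  hom_small M N := by
    have h {M N : t.Heart} {a b : ℤ} {X Y : A} (hM : M.obj = (singleFunctor A a).obj X)
        (hN : N.obj = (singleFunctor A b).obj Y) : Small.{w'} (M ⟶ N) := by
      have : Small.{w'} (M.obj ⟶ N.obj) := by
        rw [hM, hN]
        infer_instance
      exact small_of_injective (f := fun f : M ⟶ N ↦ f.hom)
        (fun f g hfg ↦ ObjectProperty.hom_ext _ hfg)
    obtain ⟨X, Y, i, p, w, hS⟩ := t.exists_shortExact_heart M
    obtain ⟨X', Y', i', p', w', hS'⟩ := t.exists_shortExact_heart N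
    have := hS.epi_g
    have := hS'.mono_f
    have : Small.{w'} (t.freeToHeart.obj X ⟶ t.freeToHeart.obj X') := h rfl rfl
    have : Small.{w'} (t.freeToHeart.obj X ⟶ t.torsionToHeart.obj Y') := h rfl rfl
    have : Small.{w'} (t.torsionToHeart.obj Y ⟶ t.freeToHeart.obj X') := h rfl rfl
    have : Small.{w'} (t.torsionToHeart.obj Y ⟶ t.torsionToHeart.obj Y') := h rfl rfl
    have h₁ : Small.{w'} (t.freeToHeart.obj X ⟶ N) := small_hom_to_of_exact hS'.exact _
    have h₂ : Small.{w'} (t.torsionToHeart.obj Y ⟶ N) := small_hom_to_of_exact hS'.exact _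
    exact small_hom_from_of_exact hS.exact N

lemma exists_torsionToHeart_iso_kernel {X : t.torsion.FullSubcategory} {N : t.Heart}
    (g : t.torsionToHeart.obj X ⟶ N) :
    ∃ Y : t.torsion.FullSubcategory, Nonempty (t.torsionToHeart.obj Y ≅ kernel g) := by
  obtain ⟨K, Y, i, p, w, hS⟩ := t.exists_shortExact_heart (kernel g)
  have := hS.epi_g
  have hi : i = 0 := by
    rw [← cancel_mono (kernel.ι g), t.freeToHeart_hom_eq_zero (i ≫ kernel.ι g), zero_comp]
  have : Mono p := hS.exact.mono_g hi
  have : IsIso p := isIso_of_mono_of_epi p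
  exact ⟨Y, ⟨(asIso p).symm⟩⟩

lemma torsionToHeart_hom_eq_zero {J : Type*} [Category* J] {F : J ⥤ t.torsion.FullSubcategory}
    {c : Cocone F} (hc : IsColimit c) {N : t.Heart} (g : t.torsionToHeart.obj c.pt ⟶ N)
    (h : ∀ j, t.torsionToHeart.map (c.ι.app j) ≫ g = 0) : g = 0 := by
  obtain ⟨Y, ⟨e⟩⟩ := t.exists_torsionToHeart_iso_kernel g
  obtain ⟨z, hz⟩ := t.torsionToHeart.map_surjective (e.hom ≫ kernel.ι g)
  have hzg : t.torsionToHeart.map z ≫ g = 0 := by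
    rw [hz, Category.assoc, kernel.condition, comp_zero]
  have : Mono (t.torsionToHeart.map z) := by
    rw [hz]
    infer_instance
  have : Mono z := t.torsionToHeart.mono_of_mono_map this
  choose φ hφ using fun j ↦ t.torsionToHeart.map_surjective (kernel.lift g _ (h j) ≫ e.inv)
  have hφz (j) : φ j ≫ z = c.ι.app j := t.torsionToHeart.map_injective (by
    rw [Functor.map_comp, hφ, hz]
    simp)
  have hφw {j j'} (f : j ⟶ j') : F.map f ≫ φ j' = φ j := by
    rw [← cancel_mono z, Category.assoc, hφz, hφz, c.w]
  let s : Cocone F :=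
    { pt := Y
      ι := { app := φ, naturality _ _ f := (hφw f).trans (Category.comp_id _).symm } }
  have hσ : hc.desc s ≫ z = 𝟙 c.pt := hc.hom_ext fun j ↦ by
    rw [hc.fac_assoc s j, hφz, Category.comp_id]
  rw [← Category.id_comp g, ← CategoryTheory.Functor.map_id, ← hσ, Functor.map_comp,
    Category.assoc, hzg, comp_zero]

end TorsionPair

/-! ### Separators and filtered colimits of small objects -/

namespace HRS

variable {A : Type u} [Category.{v} A] [Abelian A]

lemma exists_epi_comp_of_isSeparator {X : A} (hX : IsSeparator X) {W V : A} (q : W ⟶ V) [Epi q]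
    [Small.{w} (Subobject V)] [HasCoproduct fun _ : Shrink.{w} (Subobject V) ↦ X] :
    ∃ h : (∐ fun _ : Shrink.{w} (Subobject V) ↦ X) ⟶ W, Epi (h ≫ q) := by
  classical
  have hσ (s : Shrink.{w} (Subobject V)) : ∃ y : X ⟶ W, ∀ x : X ⟶ W,
      imageSubobject (x ≫ q) = (equivShrink _).symm s →
        imageSubobject (y ≫ q) = (equivShrink _).symm s := by
    by_cases h : ∃ y : X ⟶ W, imageSubobject (y ≫ q) = (equivShrink _).symm s
    · obtain ⟨y, hy⟩ := h
      exact ⟨y, fun _ _ ↦ hy⟩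
    · exact ⟨0, fun x hx ↦ (h ⟨x, hx⟩).elim⟩
  choose σ hσ using hσ
  refine ⟨Limits.Sigma.desc σ, ⟨fun {Z} a b hab ↦ ?_⟩⟩
  rw [← cancel_epi q]
  refine IsSeparator.def hX _ _ fun x ↦ ?_
  let s := equivShrink.{w} _ (imageSubobject (x ≫ q))
  have hs : imageSubobject (σ s ≫ q) = imageSubobject (x ≫ q) := by
    rw [hσ s x (by simp [s])]
    simp [s]
  have h₁ : (σ s ≫ q) ≫ a = (σ s ≫ q) ≫ b := by
    have := congr_arg (Sigma.ι (fun _ : Shrink.{w} (Subobject V) ↦ X) s ≫ ·) hab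
    simpa using this
  have h₂ : (imageSubobject (σ s ≫ q)).arrow ≫ a = (imageSubobject (σ s ≫ q)).arrow ≫ b := by
    rw [← cancel_epi (factorThruImageSubobject (σ s ≫ q)), imageSubobject_arrow_comp_assoc, h₁,
      imageSubobject_arrow_comp_assoc]
  rw [hs] at h₂
  rw [← Category.assoc, ← Category.assoc, ← imageSubobject_arrow_comp (x ≫ q), Category.assoc, h₂,
    Category.assoc]

lemma nonempty_isColimit_of_isSeparator {X : A} (hX : IsSeparator X) {J : Type*} [Category* J]
    [IsConnected J] [HasColimitsOfShape J A] [HasExactColimitsOfShape J A] {F : J ⥤ A} {T : A}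
    (ι : F ⟶ (Functor.const J).obj T) [∀ j, Mono (ι.app j)]
    (hι : ∀ x : X ⟶ T, ∃ (j : J) (y : X ⟶ F.obj j), y ≫ ι.app j = x) :
    Nonempty (IsColimit (Cocone.mk T ι)) := by
  have := NatTrans.mono_of_mono_app ι
  have := HasExactColimitsOfShape.preservesFiniteLimits (J := J) (C := A)
  let m : colimit F ⟶ T := colimit.desc F ⟨T, ι⟩
  have hm (j) : colimit.ι F j ≫ m = ι.app j := colimit.ι_desc _ _
  have : Mono m := colim.map_mono' ι (colimit.isColimit F) (isColimitConstCocone _ _) m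
    fun j ↦ (hm j).trans (Category.comp_id _).symm
  have : Epi m := ⟨fun a b hab ↦ IsSeparator.def hX _ _ fun x ↦ by
    obtain ⟨j, y, rfl⟩ := hι x
    simp only [← hm, Category.assoc, hab]⟩
  have : IsIso ((colimit.isColimit F).desc ⟨T, ι⟩) := isIso_of_mono_of_epi m
  exact ⟨IsColimit.ofPointIso (colimit.isColimit F)⟩

attribute [local instance] IsFiltered.isConnected

lemma exists_isColimit_of_isSeparator [IsGrothendieckAbelian.{w} A] {X : A} (hX : IsSeparator X)
    (T : A) : ∃ (J : Type w) (_ : SmallCategory J) (_ : IsFiltered J) (F : J ⥤ A)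
      (ι : F ⟶ (Functor.const J).obj T), Nonempty (IsColimit (Cocone.mk T ι)) ∧
      (∀ j, Mono (ι.app j)) ∧ ∀ j, ∃ (n : ℕ) (p : (∐ fun _ : Fin n ↦ X) ⟶ F.obj j), Epi p := by
  classical
  let S := Shrink.{w} (X ⟶ T)
  let x : S → (X ⟶ T) := (equivShrink _).symm
  let f (s : Finset S) : (∐ fun _ : s ↦ X) ⟶ T := Limits.Sigma.desc fun y ↦ x y
  let D (s : Finset S) : Subobject T := imageSubobject (f s)
  have hD : Monotone D := fun s s' h ↦ by
    have : f s = (Limits.Sigma.desc fun y : s ↦ Sigma.ι (fun _ : s' ↦ X) ⟨y, h y.2⟩) ≫ f s' :=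
      Limits.Sigma.hom_ext _ _ fun y ↦ by simp [f]
    dsimp only [D]
    rw [this]
    exact imageSubobject_comp_le _ _
  let F : Finset S ⥤ A := hD.functor ⋙ Subobject.underlying
  let ι : F ⟶ (Functor.const _).obj T :=
    { app s := (D s).arrow
      naturality s s' h := (Subobject.underlying_arrow _).trans (Category.comp_id _).symm }
  let π (s : Finset S) : (∐ fun _ : s ↦ X) ⟶ F.obj s := factorThruImageSubobject (f s)
  have hπ (s : Finset S) : π s ≫ ι.app s = f s := imageSubobject_arrow_comp (f s)
  have hepi (s : Finset S) : Epi (π s) := inferInstanceAs (Epi (factorThruImageSubobject (f s)))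
  have hι (s) : Mono (ι.app s) := inferInstanceAs (Mono (D s).arrow)
  refine ⟨Finset S, inferInstance, inferInstance, F, ι,
    nonempty_isColimit_of_isSeparator hX ι fun y ↦ ?_, hι, fun s ↦ ?_⟩
  · let s : Finset S := {equivShrink _ y}
    let i : s := ⟨equivShrink _ y, by simp [s]⟩
    refine ⟨s, Sigma.ι (fun _ : s ↦ X) i ≫ π s, ?_⟩
    rw [Category.assoc, hπ]
    simp [f, x, i]
  · let e := Sigma.reindex s.equivFin.symm (fun _ : s ↦ X)
    exact ⟨s.card, e.hom ≫ π s, epi_comp _ _⟩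

end HRS

namespace TorsionPair

variable {A : Type u} [Category.{v} A] [Abelian A] (t : TorsionPair A)

lemma nonempty_isColimit_torsionFunctor {J : Type*} [Category* J] [HasColimitsOfShape J A]
    [HasExactColimitsOfShape J A] [t.torsionFree.IsClosedUnderColimitsOfShape J] (F : J ⥤ A)
    {T : A} (ι : F ⟶ (Functor.const J).obj T) (hι : IsColimit (Cocone.mk T ι))
    (hT : t.torsion T) :
    Nonempty (IsColimit (Cocone.mk T (Functor.whiskerLeft F t.torsionFunctorι ≫ ι))) := by
  have := HasExactColimitsOfShape.preservesFiniteLimits (J := J) (C := A)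
  have hS := t.functorShortComplex_shortExact F
  let hc := colimit.isColimit (F ⋙ t.torsionFunctor)
  let hc₃ := colimit.isColimit (F ⋙ t.freeFunctor)
  let m : colimit (F ⋙ t.torsionFunctor) ⟶ T :=
    hc.desc (Cocone.mk T (Functor.whiskerLeft F t.torsionFunctorι ≫ ι))
  have hm (j) : colimit.ι (F ⋙ t.torsionFunctor) j ≫ m = t.torsionPartι (F.obj j) ≫ ι.app j :=
    hc.fac _ j
  let g : T ⟶ colimit (F ⋙ t.freeFunctor) :=
    hι.desc (Cocone.mk _ (Functor.whiskerLeft F t.freeFunctorπ ≫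
      (colimit.cocone (F ⋙ t.freeFunctor)).ι))
  have hg (j) : ι.app j ≫ g = t.freePartπ (F.obj j) ≫ colimit.ι (F ⋙ t.freeFunctor) j :=
    hι.fac _ j
  have : Mono (t.functorShortComplex F).f := hS.mono_f
  have : Mono m := colim.map_mono' (t.functorShortComplex F).f hc hι m hm
  have : Epi m := (colim.exact_mapShortComplex hS.exact hc hι hc₃ m g hm hg).epi_f
    (t.hom_eq_zero _ hT (t.torsionFree.prop_colimit _ fun j ↦ t.torsionFree_freePart _))
  have : IsIso m := isIso_of_mono_of_epi m
  exact ⟨IsColimit.ofPointIso hc⟩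

end TorsionPair

/-! ### Test objects in the heart -/

namespace HRS

variable {A : Type u} [Category.{v} A] [Abelian A]

lemma exists_subobject_cokernel_iso {P Y : A} (p : P ⟶ Y) [Epi p] :
    ∃ R : Subobject P, Nonempty (cokernel R.arrow ≅ Y) := by
  refine ⟨Subobject.mk (kernel.ι p), ⟨?_⟩⟩
  exact cokernel.mapIso _ _ (Subobject.underlyingIso (kernel.ι p)) (Iso.refl _) (by simp) ≪≫
    (colimit.isColimit _).coconePointUniqueUpToIso
      (Abelian.epiIsCokernelOfKernel (limit.cone (parallelPair p 0)) (limit.isLimit _))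

lemma exact_comp_iff_of_mono {X₁ X₂ X₃ X₄ : A} {f : X₁ ⟶ X₂} {g : X₂ ⟶ X₃} (w : f ≫ g = 0)
    (p : X₃ ⟶ X₄) [Mono p] (w' : f ≫ g ≫ p = 0) :
    (ShortComplex.mk f (g ≫ p) w').Exact ↔ (ShortComplex.mk f g w).Exact := by
  let φ : ShortComplex.mk f g w ⟶ ShortComplex.mk f (g ≫ p) w' :=
    { τ₁ := 𝟙 _, τ₂ := 𝟙 _, τ₃ := p }
  have : Mono φ.τ₃ := ‹Mono p›
  exact (ShortComplex.exact_iff_of_epi_of_isIso_of_mono φ).symm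

lemma exact_iff_epi_factorThruKernelSubobject {X₁ X₂ X₃ : A} {f : X₁ ⟶ X₂} {g : X₂ ⟶ X₃}
    (w : f ≫ g = 0) :
    (ShortComplex.mk f g w).Exact ↔ Epi (factorThruKernelSubobject g f w) := by
  rw [ShortComplex.exact_iff_epi_kernel_lift, ← factorThruKernelSubobject_comp_kernelSubobjectIso,
    epi_comp_iff_of_isIso]

lemma exists_mono_comp_epi_of_isSeparator {X : A} (hX : IsSeparator X) {W V : A} (q : W ⟶ V)
    [Epi q] [Small.{w'} (Subobject V)] [HasCoproduct fun _ : Shrink.{w'} (Subobject V) ↦ X] :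
    ∃ (R : Subobject (∐ fun _ : Shrink.{w'} (Subobject V) ↦ X)) (m : cokernel R.arrow ⟶ W),
      Mono m ∧ Epi (m ≫ q) := by
  obtain ⟨f, hf⟩ := exists_epi_comp_of_isSeparator.{w'} hX q
  obtain ⟨R, ⟨e⟩⟩ := exists_subobject_cokernel_iso (Abelian.factorThruImage f)
  have : Epi ((Abelian.factorThruImage f ≫ e.inv) ≫ (e.hom ≫ Abelian.image.ι f) ≫ q) := by
    simpa using hf
  exact ⟨R, e.hom ≫ Abelian.image.ι f, mono_comp _ _,
    epi_of_epi (Abelian.factorThruImage f ≫ e.inv) _⟩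

lemma exists_exact_of_isSeparator {X : A} (hX : IsSeparator X) {W B T : A} {d : W ⟶ B}
    {e : B ⟶ T} {w : d ≫ e = 0} (h : (ShortComplex.mk d e w).Exact)
    [Small.{w'} (Subobject (kernelSubobject e : A))]
    [HasCoproduct fun _ : Shrink.{w'} (Subobject (kernelSubobject e : A)) ↦ X] :
    ∃ (R : Subobject (∐ fun _ : Shrink.{w'} (Subobject (kernelSubobject e : A)) ↦ X))
      (m : cokernel R.arrow ⟶ W) (w' : (m ≫ d) ≫ e = 0), Mono m ∧
        (ShortComplex.mk (m ≫ d) e w').Exact := by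
  have := (exact_iff_epi_factorThruKernelSubobject w).1 h
  obtain ⟨R, m, hm, hmq⟩ :=
    exists_mono_comp_epi_of_isSeparator hX (factorThruKernelSubobject e d w)
  have wm : (m ≫ d) ≫ e = 0 := by rw [Category.assoc, w, comp_zero]
  have hmd : factorThruKernelSubobject e (m ≫ d) wm = m ≫ factorThruKernelSubobject e d w := by
    rw [← cancel_mono (kernelSubobject e).arrow]
    simp only [Category.assoc, factorThruKernelSubobject_comp_arrow]
  exact ⟨R, m, wm, hm, (exact_iff_epi_factorThruKernelSubobject wm).2 (by rwa [hmd])⟩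

open DerivedCategory HomologySequence

variable [HasDerivedCategory.{w} A]

instance (n : ℤ) : (singleFunctor A n ⋙ homologyFunctor A n).IsEquivalence :=
  Functor.isEquivalence_of_iso (singleFunctorCompHomologyFunctorIso A n).symm

lemma epi_homologyMap_singleFunctor_map_iff {X Y : A} (f : X ⟶ Y) (n : ℤ) :
    Epi ((homologyFunctor A n).map ((singleFunctor A n).map f)) ↔ Epi f :=
  (singleFunctor A n ⋙ homologyFunctor A n).epi_map_iff_epi f

lemma mono_homologyMap_singleFunctor_map_iff {X Y : A} (f : X ⟶ Y) (n : ℤ) :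
    Mono ((homologyFunctor A n).map ((singleFunctor A n).map f)) ↔ Mono f :=
  (singleFunctor A n ⋙ homologyFunctor A n).mono_map_iff_mono f

lemma exact_homologyMap_singleFunctor_map_iff {X Y Z : A} {f : X ⟶ Y} {g : Y ⟶ Z}
    (w : f ≫ g = 0) (n : ℤ) (w' : (homologyFunctor A n).map ((singleFunctor A n).map f) ≫
      (homologyFunctor A n).map ((singleFunctor A n).map g) = 0) :
    (ShortComplex.mk _ _ w').Exact ↔ (ShortComplex.mk f g w).Exact :=
  ShortComplex.exact_iff_of_iso
    ((ShortComplex.mk f g w).mapNatIso (singleFunctorCompHomologyFunctorIso A n))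

lemma homologyMap_singleFunctor_map_comp_eq_zero {X Y Z : A} {f : X ⟶ Y} {g : Y ⟶ Z}
    (w : f ≫ g = 0) (n : ℤ) : (homologyFunctor A n).map ((singleFunctor A n).map f) ≫
      (homologyFunctor A n).map ((singleFunctor A n).map g) = 0 := by
  rw [← Functor.map_comp, ← Functor.map_comp, w, Functor.map_zero, Functor.map_zero]

lemma exists_singleFunctor_epi_homologyMap (M : DerivedCategory A) [M.IsLE 0] :
    ∃ (K : A) (φ : (singleFunctor A 0).obj K ⟶ M), Epi ((homologyFunctor A 0).map φ) := by
  obtain ⟨K, hK, ⟨e⟩⟩ := exists_iso_Q_obj_of_isLE M 0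
  have hd : K.d 0 1 = 0 := (K.isZero_of_isStrictlyLE 0 1).eq_of_tgt _ _
  let f : (HomologicalComplex.single A (ComplexShape.up ℤ) 0).obj (K.X 0) ⟶ K :=
    HomologicalComplex.mkHomFromSingle (𝟙 (K.X 0)) (by
      intro k hk
      obtain rfl : 1 = k := by simpa using hk
      simp [hd])
  have : Epi (f.f 0) := by
    rw [HomologicalComplex.mkHomFromSingle_f]
    infer_instance
  have : Epi (HomologicalComplex.homologyMap f 0) :=
    ((MorphismProperty.epimorphisms A).arrow_mk_iso_iff
      (Arrow.isoMk (HomologicalComplex.isoHomologyι _ 0 1 (by simp) (by simp))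
        (K.isoHomologyι 0 1 (by simp) hd) (HomologicalComplex.homologyι_naturality f 0).symm)).2
      (MorphismProperty.epimorphisms.infer_property (HomologicalComplex.opcyclesMap f 0))
  refine ⟨K.X 0, Q.map f ≫ e.inv, ?_⟩
  have : Epi ((homologyFunctor A 0).map (Q.map f)) :=
    ((MorphismProperty.epimorphisms A).arrow_mk_iso_iff
      (((Functor.mapArrowFunctor _ _).mapIso (homologyFunctorFactors A 0)).app (Arrow.mk f))).2 this
  refine (congr_arg Epi (Functor.map_comp _ (Q.map f) e.inv)).mpr ?_
  exact epi_comp _ _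

lemma exact_of_distTriang {M L : DerivedCategory A} {W B Y : A}
    {l : L ⟶ (singleFunctor A 0).obj B} {ψ : (singleFunctor A 0).obj B ⟶ M} {δ : M ⟶ L⟦(1 : ℤ)⟧}
    (hL : Triangle.mk l ψ δ ∈ distTriang _) (g : (singleFunctor A 0).obj W ⟶ L)
    [Epi ((homologyFunctor A 0).map g)] (p : M ⟶ (singleFunctor A 0).obj Y)
    [Mono ((homologyFunctor A 0).map p)] {d : W ⟶ B} (hd : (singleFunctor A 0).map d = g ≫ l)
    {f : B ⟶ Y} (hf : (singleFunctor A 0).map f = ψ ≫ p) (w : d ≫ f = 0) :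
    (ShortComplex.mk d f w).Exact := by
  have hlψ : (homologyFunctor A 0).map l ≫ (homologyFunctor A 0).map ψ = 0 := by
    have : l ≫ ψ = 0 := comp_distTriang_mor_zero₁₂ _ hL
    rw [← Functor.map_comp, this, Functor.map_zero]
  have hlψp : (homologyFunctor A 0).map l ≫ (homologyFunctor A 0).map ψ ≫
      (homologyFunctor A 0).map p = 0 := by
    rw [reassoc_of% hlψ, zero_comp]
  have h : (ShortComplex.mk _ _ hlψp).Exact :=
    (exact_comp_iff_of_mono hlψ _ hlψp).2 (exact₂ _ hL 0)
  have hd' : (homologyFunctor A 0).map ((singleFunctor A 0).map d) =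
      (homologyFunctor A 0).map g ≫ (homologyFunctor A 0).map l := by
    rw [hd, Functor.map_comp]
  have hf' : (homologyFunctor A 0).map ((singleFunctor A 0).map f) =
      (homologyFunctor A 0).map ψ ≫ (homologyFunctor A 0).map p := by
    rw [hf, Functor.map_comp]
  have w' := homologyMap_singleFunctor_map_comp_eq_zero w 0
  let φ : ShortComplex.mk _ _ w' ⟶ ShortComplex.mk _ _ hlψp :=
    { τ₁ := (homologyFunctor A 0).map g
      τ₂ := 𝟙 _
      τ₃ := 𝟙 _
      comm₁₂ := ((Category.comp_id _).trans hd').symm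
      comm₂₃ := (Category.id_comp _).trans (hf'.symm.trans (Category.comp_id _).symm) }
  have : Epi φ.τ₁ := ‹Epi ((homologyFunctor A 0).map g)›
  exact (exact_homologyMap_singleFunctor_map_iff w 0 w').1 <|
    (ShortComplex.exact_iff_of_epi_of_isIso_of_mono φ).2 h

lemma exists_exact_of_distTriang {M L : DerivedCategory A} {B T Y : A} [L.IsGE 0]
    {l : L ⟶ (singleFunctor A 0).obj B} {ψ : (singleFunctor A 0).obj B ⟶ M} {δ : M ⟶ L⟦(1 : ℤ)⟧}
    (hL : Triangle.mk l ψ δ ∈ distTriang _) (p : M ⟶ (singleFunctor A 0).obj Y)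
    [Mono ((homologyFunctor A 0).map p)] (e : B ⟶ T) (u : T ⟶ Y) [Mono u]
    (hψ : ψ ≫ p = (singleFunctor A 0).map (e ≫ u)) :
    ∃ (W : A) (g : (singleFunctor A 0).obj W ⟶ L) (d : W ⟶ B) (w : d ≫ e = 0),
      IsIso ((homologyFunctor A 0).map g) ∧ (singleFunctor A 0).map d = g ≫ l ∧
        (ShortComplex.mk d e w).Exact := by
  obtain ⟨W, g, hg, -⟩ := exists_from_single L
  obtain ⟨d, hd⟩ := (singleFunctor A 0).map_surjective (g ≫ l)
  have hlψ : l ≫ ψ = 0 := comp_distTriang_mor_zero₁₂ _ hL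
  have hdeu : d ≫ e ≫ u = 0 := (singleFunctor A 0).map_injective (by
    rw [Functor.map_comp, hd, ← hψ, Category.assoc, reassoc_of% hlψ, zero_comp, comp_zero,
      Functor.map_zero])
  have hde : d ≫ e = 0 := by rwa [← cancel_mono u, Category.assoc, zero_comp]
  exact ⟨W, g, d, hde, hg, hd,
    (exact_comp_iff_of_mono hde u hdeu).1 (exact_of_distTriang hL g p hd hψ.symm hdeu)⟩

lemma mono_homologyMap_hom₃ {T₁ T₂ : Triangle (DerivedCategory A)} (φ : T₁ ⟶ T₂)
    (hT₁ : T₁ ∈ distTriang _) (n m : ℤ) (h : n + 1 = m)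
    (h₂ : IsZero ((homologyFunctor A n).obj T₁.obj₂)) [Mono ((homologyFunctor A m).map φ.hom₁)] :
    Mono ((homologyFunctor A n).map φ.hom₃) := by
  have : Mono (HomologySequence.δ T₁ n m h) := (exact₃ _ hT₁ n m h).mono_g (h₂.eq_of_src _ _)
  have : Mono ((homologyFunctor A n).map φ.hom₃ ≫ HomologySequence.δ T₂ n m h) := by
    have := (homologyFunctor A 0).homologySequenceδ_naturality _ _ φ n m h
    exact this ▸ mono_comp (HomologySequence.δ T₁ n m h) ((homologyFunctor A m).map φ.hom₁)
  exact mono_of_mono _ (HomologySequence.δ T₂ n m h)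

lemma exists_epi_homologyFunctor_obj {S : DerivedCategory A} {Z B T : A} {a : Z ⟶ B} {e : B ⟶ T}
    [Epi e] {w : a ≫ e = 0} (he : (ShortComplex.mk a e w).Exact)
    {α : (singleFunctor A 0).obj B ⟶ S} {ε : S ⟶ ((singleFunctor A 0).obj Z)⟦(1 : ℤ)⟧}
    (hS : Triangle.mk ((singleFunctor A 0).map a) α ε ∈ distTriang _) :
    ∃ y : T ⟶ (homologyFunctor A 0).obj S, Epi y := by
  have : Epi ((homologyFunctor A 0).map α) :=
    (epi_homologyMap_mor₂_iff _ hS 0 1).2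
      ((isZero_of_isLE ((singleFunctor A 0).obj Z) 0 1 (by simp)).eq_of_tgt _ _)
  have : Epi ((homologyFunctor A 0).map ((singleFunctor A 0).map e)) :=
    (epi_homologyMap_singleFunctor_map_iff e 0).2 ‹_›
  have he' := (exact_homologyMap_singleFunctor_map_iff w 0
    (homologyMap_singleFunctor_map_comp_eq_zero w 0)).2 he
  have hα : (homologyFunctor A 0).map ((singleFunctor A 0).map a) ≫
      (homologyFunctor A 0).map α = 0 := by
    have : (singleFunctor A 0).map a ≫ α = 0 := comp_distTriang_mor_zero₁₂ _ hS
    rw [← Functor.map_comp, this, Functor.map_zero]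
  let y := he'.desc ((homologyFunctor A 0).map α) hα
  have hy : (homologyFunctor A 0).map ((singleFunctor A 0).map e) ≫ y =
      (homologyFunctor A 0).map α := he'.g_desc _ hα
  have : Epi y := epi_of_epi_fac hy
  exact ⟨((singleFunctorCompHomologyFunctorIso A 0).app T).inv ≫ y, epi_comp _ _⟩

lemma isLE_and_isGE_of_distTriang_singleFunctor {S : DerivedCategory A} {Z B : A}
    {f : (singleFunctor A 0).obj Z ⟶ (singleFunctor A 0).obj B}
    {α : (singleFunctor A 0).obj B ⟶ S} {ε : S ⟶ ((singleFunctor A 0).obj Z)⟦(1 : ℤ)⟧}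
    (hS : Triangle.mk f α ε ∈ distTriang _) : S.IsLE 0 ∧ S.IsGE (-1) := by
  have lZ : (((singleFunctor A 0).obj Z)⟦(1 : ℤ)⟧).IsLE (-1) :=
    DerivedCategory.TStructure.t.isLE_shift _ 0 1 (-1)
  have lZ' : (((singleFunctor A 0).obj Z)⟦(1 : ℤ)⟧).IsLE 0 :=
    DerivedCategory.TStructure.t.isLE_of_le _ (-1) 0
  have gZ : (((singleFunctor A 0).obj Z)⟦(1 : ℤ)⟧).IsGE (-1) :=
    DerivedCategory.TStructure.t.isGE_shift _ 0 1 (-1)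
  have lB : ((singleFunctor A 0).obj B).IsLE 0 := inferInstance
  have gB : ((singleFunctor A 0).obj B).IsGE (-1) :=
    DerivedCategory.TStructure.t.isGE_of_ge _ (-1) 0
  exact ⟨DerivedCategory.TStructure.t.isLE₂ _ (rot_of_distTriang _ hS) 0 lB lZ',
    DerivedCategory.TStructure.t.isGE₂ _ (rot_of_distTriang _ hS) (-1) gB gZ⟩

end HRS

namespace TorsionPair

open DerivedCategory HRS

variable {A : Type u} [Category.{v} A] [Abelian A] (t : TorsionPair A) [HasDerivedCategory.{w} A]

lemma exists_comp_eq_of_heart {M L S : DerivedCategory A} (hM : t.tStructure.heart M)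
    {B T W Z : A} (hT : t.torsion T) {l : L ⟶ (singleFunctor A 0).obj B}
    {ψ : (singleFunctor A 0).obj B ⟶ M} {δ : M ⟶ L⟦(1 : ℤ)⟧}
    (hL : Triangle.mk l ψ δ ∈ distTriang _) (g : (singleFunctor A 0).obj W ⟶ L)
    [IsIso ((homologyFunctor A 0).map g)] (m : Z ⟶ W) [Mono m] {a : Z ⟶ B}
    (ha : (singleFunctor A 0).map a = (singleFunctor A 0).map m ≫ g ≫ l)
    {e : B ⟶ T} [Epi e] {w : a ≫ e = 0} (he : (ShortComplex.mk a e w).Exact)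
    {α : (singleFunctor A 0).obj B ⟶ S} {ε : S ⟶ ((singleFunctor A 0).obj Z)⟦(1 : ℤ)⟧}
    (hS : Triangle.mk ((singleFunctor A 0).map a) α ε ∈ distTriang _) :
    t.tStructure.heart S ∧ ∃ c : S ⟶ M, α ≫ c = ψ := by
  obtain ⟨-, -, hM'⟩ := (t.mem_heart_iff _).1 hM
  have comm₁ : (singleFunctor A 0).map a ≫ 𝟙 _ = ((singleFunctor A 0).map m ≫ g) ≫ l := by
    rw [Category.comp_id, ha, Category.assoc]
  obtain ⟨c, comm₂, comm₃⟩ : ∃ c : S ⟶ M, α ≫ c = 𝟙 _ ≫ ψ ∧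
      ε ≫ ((singleFunctor A 0).map m ≫ g)⟦(1 : ℤ)⟧' = c ≫ δ :=
    complete_distinguished_triangle_morphism _ _ hS hL _ (𝟙 _) comm₁
  have hmg : Mono ((homologyFunctor A 0).map ((singleFunctor A 0).map m ≫ g)) := by
    have := (mono_homologyMap_singleFunctor_map_iff m 0).2 ‹_›
    rw [Functor.map_comp]
    exact mono_comp _ _
  let φ : Triangle.mk ((singleFunctor A 0).map a) α ε ⟶ Triangle.mk l ψ δ :=
    { hom₁ := (singleFunctor A 0).map m ≫ g
      hom₂ := 𝟙 _
      hom₃ := c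
      comm₁ := comm₁
      comm₂ := comm₂
      comm₃ := comm₃ }
  have : Mono ((homologyFunctor A 0).map φ.hom₁) := hmg
  have : Mono ((homologyFunctor A (-1)).map c) := mono_homologyMap_hom₃ φ hS (-1) 0 (by simp)
    (isZero_of_isGE ((singleFunctor A 0).obj B) 0 (-1) (by simp))
  obtain ⟨y, hy⟩ := exists_epi_homologyFunctor_obj he hS
  obtain ⟨hLE, hGE⟩ := isLE_and_isGE_of_distTriang_singleFunctor hS
  exact ⟨(t.mem_heart_iff _).2 ⟨⟨hLE, t.torsion_of_epi y hT⟩, hGE,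
    t.torsionFree_of_mono ((homologyFunctor A (-1)).map c) hM'⟩, c,
    comm₂.trans (Category.id_comp _)⟩

end TorsionPair

/-! ### A separator of the heart -/

namespace HRS

open DerivedCategory

variable {A : Type u} [Category.{v} A] [Abelian A] [HasDerivedCategory.{w} A]

lemma exists_epi_singleFunctor_map (M : DerivedCategory A) [M.IsLE 0] {Y : A}
    (p : M ⟶ (singleFunctor A 0).obj Y) [Epi ((homologyFunctor A 0).map p)] :
    ∃ (K : A) (φ : (singleFunctor A 0).obj K ⟶ M) (q : K ⟶ Y),
      Epi q ∧ (singleFunctor A 0).map q = φ ≫ p := by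
  obtain ⟨K, φ, hφ⟩ := exists_singleFunctor_epi_homologyMap M
  obtain ⟨q, hq⟩ := (singleFunctor A 0).map_surjective (φ ≫ p)
  refine ⟨K, φ, q, (epi_homologyMap_singleFunctor_map_iff q 0).1 ?_, hq⟩
  rw [hq, Functor.map_comp]
  exact epi_comp _ _

/-- The cone in the derived category of a morphism of `A`, as an arbitrary choice of a completion
to a distinguished triangle. -/
noncomputable def cone {Z B : A} (a : Z ⟶ B) : DerivedCategory A :=
  (distinguished_cocone_triangle ((singleFunctor A 0).map a)).choose

lemma exists_distTriang_cone {Z B : A} (a : Z ⟶ B) :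
    ∃ (α : (singleFunctor A 0).obj B ⟶ cone a)
      (δ : cone a ⟶ ((singleFunctor A 0).obj Z)⟦(1 : ℤ)⟧),
      Triangle.mk ((singleFunctor A 0).map a) α δ ∈ distTriang _ :=
  (distinguished_cocone_triangle ((singleFunctor A 0).map a)).choose_spec

/-- The coproduct of copies of `X` indexed by the subobjects of `T`, which is large enough to cover
all the quotients `W ⟶ T` when `X` is a separator. -/
noncomputable abbrev coproductCopies {A : Type u} [Category.{v} A] [Abelian A]
    [IsGrothendieckAbelian.{w'} A] (X T : A) : A :=
  ∐ fun _ : Shrink.{w'} (Subobject T) ↦ X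

end HRS

namespace TorsionPair

open DerivedCategory HRS

variable {A : Type u} [Category.{v} A] [Abelian A] (t : TorsionPair A) [HasDerivedCategory.{w} A]

lemma isIso_homologyMap_zero_of_shortExact {M : t.Heart} {N : t.torsionFree.FullSubcategory}
    {Y : t.torsion.FullSubcategory} (i : t.freeToHeart.obj N ⟶ M) (p : M ⟶ t.torsionToHeart.obj Y)
    (w : i ≫ p = 0) (h : (ShortComplex.mk i p w).ShortExact) :
    IsIso ((homologyFunctor A 0).map p.hom) := by
  obtain ⟨δ, hδ⟩ := exists_distTriang_of_shortExact_heart t.tStructure _ h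
  exact isIso_homologyMap_mor₂ _ hδ 0 1 rfl
    (isZero_of_isLE ((singleFunctor A (-1)).obj N.obj) (-1) 0 (by simp))
    (isZero_of_isLE ((singleFunctor A (-1)).obj N.obj) (-1) 1 (by simp))

lemma exists_freeToHeart_comp_ne_zero {X : A} (hX : IsSeparator X)
    {N : t.torsionFree.FullSubcategory} {P : t.Heart} (f : t.freeToHeart.obj N ⟶ P) (hf : f ≠ 0) :
    ∃ (R : Subobject X) (hR : t.torsionFree (cokernel R.arrow))
      (c : t.freeToHeart.obj ⟨_, hR⟩ ⟶ t.freeToHeart.obj N), c ≫ f ≠ 0 := by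
  obtain ⟨N', Y, i, p, w, hS⟩ := t.exists_shortExact_heart P
  have := hS.mono_f
  obtain ⟨φ, hφ⟩ := t.freeToHeart.map_surjective (hS.exact.lift f (t.freeToHeart_hom_eq_zero _))
  have hφ' : t.freeToHeart.map φ ≫ i = f := by
    rw [hφ]
    exact hS.exact.lift_f _ _
  by_contra! H
  refine hf ?_
  suffices h : φ.hom = 0 by
    rw [← hφ', show φ = 0 from by ext; exact h, Functor.map_zero, zero_comp]
  refine IsSeparator.def hX _ _ fun x ↦ ?_
  obtain ⟨R, ⟨e⟩⟩ := exists_subobject_cokernel_iso (Abelian.factorThruImage x)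
  have hR : t.torsionFree (cokernel R.arrow) :=
    t.torsionFree_of_mono (e.hom ≫ Abelian.image.ι x) N.property
  let c : (⟨cokernel R.arrow, hR⟩ : t.torsionFree.FullSubcategory) ⟶ N :=
    ObjectProperty.homMk (e.hom ≫ Abelian.image.ι x)
  have h := H R hR (t.freeToHeart.map c)
  rw [← hφ', ← Category.assoc, ← zero_comp (f := i), cancel_mono, ← Functor.map_comp] at h
  have h' : (e.hom ≫ Abelian.image.ι x) ≫ φ.hom = 0 :=
    congr_arg (·.hom) (t.freeToHeart.map_injective (h.trans (Functor.map_zero _ _ _).symm))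
  rw [← Abelian.image.fac x, comp_zero, Category.assoc, ← e.inv_hom_id_assoc (Abelian.image.ι x),
    Category.assoc, h', comp_zero, comp_zero]

lemma torsionToHeart_map_comp_eq_zero {S : t.Heart} {Z B T : A} {a : Z ⟶ B} {e : B ⟶ T} [Epi e]
    {w : a ≫ e = 0} (h : (ShortComplex.mk a e w).Exact) (hT : t.torsion T)
    (α : (singleFunctor A 0).obj B ⟶ S.obj) (hα : (singleFunctor A 0).map a ≫ α = 0)
    {Y : t.torsion.FullSubcategory} (v : S ⟶ t.torsionToHeart.obj Y) (u : T ⟶ Y.obj)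
    (hv : α ≫ v.hom = (singleFunctor A 0).map (e ≫ u)) {P : t.Heart}
    (g : t.torsionToHeart.obj Y ⟶ P) (hg : v ≫ g = 0) :
    t.torsionToHeart.map (X := ⟨T, hT⟩) (ObjectProperty.homMk u) ≫ g = 0 := by
  obtain ⟨N, Y', i, p, w', hS⟩ := t.exists_shortExact_heart S
  have := hS.epi_g
  obtain ⟨s, hs⟩ := t.torsionToHeart.map_surjective (hS.exact.desc v (t.freeToHeart_hom_eq_zero _))
  have hs' : p ≫ t.torsionToHeart.map s = v := by
    rw [hs]
    exact hS.exact.g_desc _ _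
  let p' : S.obj ⟶ (singleFunctor A 0).obj Y'.obj := p.hom
  obtain ⟨β, hβ⟩ := (singleFunctor A 0).map_surjective (α ≫ p')
  have haβ : a ≫ β = 0 := (singleFunctor A 0).map_injective (by
    rw [Functor.map_comp, hβ, reassoc_of% hα, zero_comp, Functor.map_zero])
  let b : T ⟶ Y'.obj := h.desc β haβ
  have hb : e ≫ b = β := h.g_desc β haβ
  have hbs : b ≫ s.hom = u := by
    rw [← cancel_epi e, reassoc_of% hb]
    refine (singleFunctor A 0).map_injective ?_
    rw [← hv, Functor.map_comp, hβ, Category.assoc, ← hs']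
    rfl
  let b' : (⟨T, hT⟩ : t.torsion.FullSubcategory) ⟶ Y' := ObjectProperty.homMk b
  have hu : (ObjectProperty.homMk u : (⟨T, hT⟩ : t.torsion.FullSubcategory) ⟶ Y) = b' ≫ s := by
    ext
    exact hbs.symm
  have hsg : t.torsionToHeart.map s ≫ g = 0 := by
    rw [← cancel_epi p, comp_zero, ← Category.assoc, hs', hg]
  rw [hu, Functor.map_comp, Category.assoc, hsg, comp_zero]

lemma exists_exact_and_cone_mem_heart {X : A} (hX : IsSeparator X) {M : DerivedCategory A}
    (hM : t.tStructure.heart M) {B T Y : A} (ψ : (singleFunctor A 0).obj B ⟶ M)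
    (p : M ⟶ (singleFunctor A 0).obj Y) [Mono ((homologyFunctor A 0).map p)] (e : B ⟶ T) [Epi e]
    (hT : t.torsion T) (u : T ⟶ Y) [Mono u] (hψ : ψ ≫ p = (singleFunctor A 0).map (e ≫ u))
    [Small.{w'} (Subobject (kernelSubobject e : A))]
    [HasCoproduct fun _ : Shrink.{w'} (Subobject (kernelSubobject e : A)) ↦ X] :
    ∃ (R : Subobject (∐ fun _ : Shrink.{w'} (Subobject (kernelSubobject e : A)) ↦ X))
      (a : cokernel R.arrow ⟶ B) (w : a ≫ e = 0), (ShortComplex.mk a e w).Exact ∧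
      ∀ (S : DerivedCategory A) (α : (singleFunctor A 0).obj B ⟶ S)
        (δ : S ⟶ ((singleFunctor A 0).obj (cokernel R.arrow))⟦(1 : ℤ)⟧),
        Triangle.mk ((singleFunctor A 0).map a) α δ ∈ distTriang _ →
          t.tStructure.heart S ∧ ∃ c : S ⟶ M, α ≫ c = ψ := by
  obtain ⟨-, hM₁, -⟩ := (t.mem_heart_iff _).1 hM
  obtain ⟨L, l, δ, hL⟩ := distinguished_cocone_triangle₁ ψ
  have gM : IsGE (M⟦(-1 : ℤ)⟧) 0 := DerivedCategory.TStructure.t.isGE_shift M (-1) (-1) 0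
  have gB : ((singleFunctor A 0).obj B).IsGE 0 := inferInstance
  have gL : L.IsGE 0 := DerivedCategory.TStructure.t.isGE₂ _ (inv_rot_of_distTriang _ hL) 0 gM gB
  obtain ⟨W, x, d, wde, hx, hd, hde⟩ := exists_exact_of_distTriang hL p e u hψ
  obtain ⟨R, m, wm, hm, hme⟩ := exists_exact_of_isSeparator.{v, u, w'} hX hde
  exact ⟨R, m ≫ d, wm, hme, fun S α ε hS ↦
    t.exists_comp_eq_of_heart hM hT hL x m (by rw [Functor.map_comp, hd]) hme hS⟩

lemma torsionToHeart_hom_eq_zero_of_isColimit {J : Type*} [Category* J]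
    [HasColimitsOfShape J A] [HasExactColimitsOfShape J A]
    [t.torsionFree.IsClosedUnderColimitsOfShape J] {F : J ⥤ A} {Y : t.torsion.FullSubcategory}
    {ι : F ⟶ (Functor.const J).obj Y.obj} (hι : IsColimit (Cocone.mk Y.obj ι)) {P : t.Heart}
    (g : t.torsionToHeart.obj Y ⟶ P)
    (h : ∀ j, t.torsionToHeart.map (X := ⟨_, t.torsion_torsionPart (F.obj j)⟩)
      (ObjectProperty.homMk (t.torsionPartι _ ≫ ι.app j)) ≫ g = 0) : g = 0 := by
  obtain ⟨hc⟩ := t.nonempty_isColimit_torsionFunctor F ι hι Y.property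
  let F' : J ⥤ t.torsion.FullSubcategory :=
    t.torsion.lift (F ⋙ t.torsionFunctor) fun j ↦ t.torsion_torsionPart (F.obj j)
  let c : Cocone F' :=
    { pt := Y
      ι :=
        { app j := ObjectProperty.homMk (t.torsionPartι _ ≫ ι.app j)
          naturality j j' f := by
            ext
            exact (Functor.whiskerLeft F t.torsionFunctorι ≫ ι).naturality f } }
  have hc' : IsColimit (t.torsion.ι.mapCocone c) := hc
  exact t.torsionToHeart_hom_eq_zero (isColimitOfReflects t.torsion.ι hc') g h

/-- The set of indices of the test objects which detect nonzero morphisms out of torsion objects.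
Given a separator `X`, one chooses a quotient of a finite coproduct of copies of `X` by `R`, whose
torsion part is covered by a coproduct of copies of `X`; the kernel `V` of this cover is itself
covered by a quotient by `R'` of a coproduct of copies of `X`, and the test object is the cone
of the resulting morphism `a`. -/
structure TestIndex [IsGrothendieckAbelian.{w'} A] (X : A) where
  n : ℕ
  R : Subobject (∐ fun _ : Fin n ↦ X)
  V : Subobject (coproductCopies.{v, u, w'} X (t.torsionPart (cokernel R.arrow)))
  R' : Subobject (coproductCopies.{v, u, w'} X (V : A))
  a : cokernel R'.arrow ⟶ coproductCopies.{v, u, w'} X (t.torsionPart (cokernel R.arrow))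
  heart : t.tStructure.heart (cone a)

variable [IsGrothendieckAbelian.{w'} A]

instance (X : A) : Small.{w'} (t.TestIndex.{w, v, u, w'} X) := by
  let f (i : t.TestIndex.{w, v, u, w'} X) : Σ (n : ℕ) (R : Subobject (∐ fun _ : Fin n ↦ X))
    (V : Subobject (coproductCopies.{v, u, w'} X (t.torsionPart (cokernel R.arrow))))
    (R' : Subobject (coproductCopies.{v, u, w'} X (V : A))),
    (cokernel R'.arrow ⟶ coproductCopies.{v, u, w'} X (t.torsionPart (cokernel R.arrow))) :=
      ⟨i.n, i.R, i.V, i.R', i.a⟩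
  refine small_of_injective (f := f) ?_
  rintro ⟨⟩ ⟨⟩ h
  cases h
  rfl

/-- The object of the heart attached to an index. -/
noncomputable def TestIndex.obj {X : A} (i : t.TestIndex.{w, v, u, w'} X) : t.Heart :=
  ⟨cone i.a, i.heart⟩

lemma exists_torsionPart_comp_ne_zero {X : A} (hX : IsSeparator X)
    (ht : IsClosedUnderDirectLimits.{w'} t.torsionFree) {Y : t.torsion.FullSubcategory}
    {P : t.Heart} (g : t.torsionToHeart.obj Y ⟶ P) (hg : g ≠ 0) :
    ∃ (n : ℕ) (R : Subobject (∐ fun _ : Fin n ↦ X)) (u : t.torsionPart (cokernel R.arrow) ⟶ Y.obj),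
      Mono u ∧ t.torsionToHeart.map (X := ⟨_, t.torsion_torsionPart _⟩) (ObjectProperty.homMk u) ≫ g
        ≠ 0 := by
  obtain ⟨J, _, _, F, ι, ⟨hι⟩, hι', hF⟩ := exists_isColimit_of_isSeparator.{w'} hX Y.obj
  have := ht.of_isFiltered J
  by_contra! H
  refine hg (t.torsionToHeart_hom_eq_zero_of_isColimit hι g fun j ↦ ?_)
  obtain ⟨n, q, _⟩ := hF j
  obtain ⟨R, ⟨e⟩⟩ := exists_subobject_cokernel_iso q
  have := hι' j
  let k : t.torsionPart (cokernel R.arrow) ≅ t.torsionPart (F.obj j) := t.torsionFunctor.mapIso e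
  have h := H n R (k.hom ≫ t.torsionPartι _ ≫ ι.app j) (mono_comp _ _)
  let k' : (⟨t.torsionPart (F.obj j), t.torsion_torsionPart _⟩ : t.torsion.FullSubcategory) ⟶
    ⟨t.torsionPart (cokernel R.arrow), t.torsion_torsionPart _⟩ := ObjectProperty.homMk k.inv
  have h' := congr_arg (t.torsionToHeart.map k' ≫ ·) h
  rw [← Category.assoc, ← Functor.map_comp, comp_zero] at h'
  refine Eq.trans ?_ h'
  congr 2
  ext
  exact (k.inv_hom_id_assoc _).symm

lemma TestIndex.exists_comp_ne_zero {X : A} (hX : IsSeparator X)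
    (ht : IsClosedUnderDirectLimits.{w'} t.torsionFree) {M : t.Heart}
    {Y : t.torsion.FullSubcategory} (p : M ⟶ t.torsionToHeart.obj Y)
    [IsIso ((homologyFunctor A 0).map p.hom)] {P : t.Heart} (g : t.torsionToHeart.obj Y ⟶ P)
    (hg : g ≠ 0) : ∃ (k : t.TestIndex.{w, v, u, w'} X) (c : k.obj ⟶ M), c ≫ p ≫ g ≠ 0 := by
  obtain ⟨n, R, u, hu, hug⟩ := t.exists_torsionPart_comp_ne_zero hX ht g hg
  obtain ⟨⟨hM, -⟩, -⟩ := (t.mem_heart_iff _).1 M.property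
  let p' : M.obj ⟶ (singleFunctor A 0).obj Y.obj := p.hom
  have : IsIso ((homologyFunctor A 0).map p') := ‹_›
  obtain ⟨K, φ, q, _, hq⟩ := exists_epi_singleFunctor_map M.obj p'
  obtain ⟨b, hb⟩ := exists_epi_comp_of_isSeparator.{w'} hX (pullback.snd q u)
  let e := b ≫ pullback.snd q u
  let ψ := (singleFunctor A 0).map (b ≫ pullback.fst q u) ≫ φ
  have hψ : ψ ≫ p' = (singleFunctor A 0).map (e ≫ u) := by
    rw [Category.assoc, ← hq, ← Functor.map_comp, Category.assoc, Category.assoc,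
      pullback.condition]
  obtain ⟨R', a, w', hae, ha⟩ := t.exists_exact_and_cone_mem_heart.{w, v, u, w'} hX M.property
    ψ p' e (t.torsion_torsionPart _) u hψ
  obtain ⟨α, ε, hS⟩ := exists_distTriang_cone a
  obtain ⟨hcone, c, hc⟩ := ha _ α ε hS
  let S : t.Heart := ⟨cone a, hcone⟩
  let c' : S ⟶ M := ObjectProperty.homMk c
  have hαcp : α ≫ (c' ≫ p).hom = (singleFunctor A 0).map (e ≫ u) := by
    rw [← hψ, ← hc, Category.assoc]
    rfl
  exact ⟨⟨n, R, kernelSubobject e, R', a, hcone⟩, c', fun hz ↦ hug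
    (t.torsionToHeart_map_comp_eq_zero hae (t.torsion_torsionPart _) α
      (comp_distTriang_mor_zero₁₂ _ hS) (c' ≫ p) u hαcp g ((Category.assoc _ _ _).trans hz))⟩

lemma hasSeparator_heart (ht : IsClosedUnderDirectLimits.{w'} t.torsionFree)
    [HasCoproducts.{w'} t.Heart] : HasSeparator t.Heart := by
  obtain ⟨X, hX⟩ := IsGrothendieckAbelian.hasSeparator.{w'} (C := A)
  let I := t.TestIndex.{w, v, u, w'} X ⊕ { R : Subobject X // t.torsionFree (cokernel R.arrow) }
  let S : I → t.Heart := Sum.elim (fun k ↦ k.obj) (fun R ↦ t.freeToHeart.obj ⟨_, R.2⟩)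
  refine ⟨⟨∐ fun k : Shrink.{w'} I ↦ S ((equivShrink I).symm k),
    ObjectProperty.IsSeparating.isSeparator_coproduct ?_⟩⟩
  rw [Preadditive.isSeparating_iff]
  intro M P f hf
  replace hf (k : I) (c : S k ⟶ M) : c ≫ f = 0 := by
    obtain ⟨k, rfl⟩ := (equivShrink I).symm.surjective k
    exact hf _ (ObjectProperty.ofObj_apply _ k) c
  obtain ⟨N, Y, i, p, w, hS⟩ := t.exists_shortExact_heart M
  have := hS.epi_g
  have hif : i ≫ f = 0 := by
    by_contra h
    obtain ⟨R, hR, c, hc⟩ := t.exists_freeToHeart_comp_ne_zero hX (i ≫ f) h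
    refine hc ?_
    rw [← Category.assoc]
    exact hf (Sum.inr ⟨R, hR⟩) (c ≫ i)
  obtain ⟨g, rfl⟩ : ∃ g, p ≫ g = f := ⟨hS.exact.desc f hif, hS.exact.g_desc _ _⟩
  by_contra h
  have := t.isIso_homologyMap_zero_of_shortExact i p w hS
  obtain ⟨k, c, hc⟩ := TestIndex.exists_comp_ne_zero t hX ht p g
    (fun hg ↦ h (by rw [hg, comp_zero]))
  exact hc (hf (Sum.inl k) c)

theorem isGrothendieckAbelian_heart (ht : IsClosedUnderDirectLimits.{w'} t.torsionFree) :
    IsGrothendieckAbelian.{w'} t.Heart := by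
  obtain ⟨_, _⟩ := t.isAB5_heart ht
  have : HasCoproducts.{w'} t.Heart := hasCoproducts_of_finite_and_filtered
  have := IsGrothendieckAbelian.hasExt.{w'} A
  exact
    { locallySmall := t.locallySmall_heart
      hasSeparator := t.hasSeparator_heart ht }

end TorsionPair

theorem mainTheorem4_general {G : Type u} [Category.{v} G] [Abelian G]
    [IsGrothendieckAbelian.{w'} G] [HasDerivedCategory.{w} G] (t : TorsionPair G) :
    List.TFAE [IsGrothendieckAbelian.{w'} t.Heart, IsAB5.{w'} t.Heart,
      IsClosedUnderDirectLimits.{w'} t.torsionFree] := by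
  tfae_have 1 → 2 := fun h ↦ ⟨h.hasFilteredColimitsOfSize, h.ab5OfSize⟩
  tfae_have 2 → 3 := t.isClosedUnderDirectLimits_of_isAB5_heart
  tfae_have 3 → 1 := t.isGrothendieckAbelian_heart
  tfae_finish

theorem mainTheorem4 {G : Type u} [Category.{v} G] [Abelian G] [IsGrothendieckAbelian.{v} G]
    [HasDerivedCategory.{w} G] (t : TorsionPair G) :
    ((t.IsHereditary ∨
        t.HeartRepresentedByTwoTermComplexes t.torsionFree ∨
        t.HeartRepresentedByTwoTermComplexes t.torsion) →
      List.TFAE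
        [IsGrothendieckAbelian.{v} t.Heart,
          IsAB5.{v} t.Heart,
          IsClosedUnderDirectLimits.{v} t.torsionFree]) ∧
    ((IsGeneratingClass t.torsionFree ∨ IsCogeneratingClass t.torsion) →
      (IsGrothendieckAbelian.{v} t.Heart ↔ IsClosedUnderDirectLimits.{v} t.torsionFree)) := by
  exact ⟨fun _ ↦ mainTheorem4_general t, fun _ ↦ (mainTheorem4_general t).out 0 2⟩
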